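/- An instance $I$ of CSP consists of a finite set of $n$ variables, a finite domain with $\mathrm{dom}$ elements, and a finite set of constraints $(S,R)$, where the scope $S$ is a non-empty sequence of distinct variables and $R$ is a set of tuples of domain elements of length $|S|$, given by listing its tuples. Every variable occurs in some scope and every domain element occurs in some tuple. The problem is to decide whether there is an assignment of domain elements to the variables that satisfies all constraints. Let $|I|$ be the length of the encoding of $I$, and let $\mathrm{tw}(I)$ be the treewidth of the primal graph of $I$, in which two distinct variables are adjacent if and only if they occur together in some scope. For $f,g:\mathbb N\to\mathbb N$ computable, $f(n)=o(g(n))$ is understood effectively: there are a computable, nondecreasing, unbounded $\mu:\mathbb N\to\mathbb N$ and $n_0$ with $f(n)\le g(n)/\mu(n)$ for all $n\ge n_0$. For a class $K$ of instances, CSP restricted to $K$ is *solvable in subexponential time* if there are a single deterministic algorithm, a computable function $f(n)=o(n)$ and constants $a,b\in\mathbb N$ such that on every input $I\in K$ with $n$ variables the algorithm correctly decides whether $I$ is satisfiable, in at most $a\cdot\mathrm{dom}^{f(n)}\,|I|^{b}$ steps, that is, in time $\mathrm{dom}^{o(n)}|I|^{O(1)}$ (for an empty domain, $\mathrm{dom}$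 is replaced by $1$ in this bound). Nothing is required on inputs outside $K$. The notion is the same for all machine models that simulate Turing machines, and are simulated by them, with polynomial overhead. **Theorem.** 1. For every computable $s:\mathbb N\to\mathbb N$ with $s(n)=o(n)$, CSP restricted to the instances $I$ with $\mathrm{tw}(I)\le s(n)$ is solvable in subexponential time. 2. For every $s:\mathbb N\to\mathbb N$ with $s(n)=\Omega(n)$ (that is, for some real $c>0$, $s(n)\ge cn$ for all large $n$): if CSP restricted to the instances $I$ with $\mathrm{tw}(I)\le s(n)$ is solvable in subexponential time, then CSP (on all instances) is solvable in subexponential time. -/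

import Mathlib

namespace CSPTime

/-! ### Machine model

The WHILE language over binary trees: a standard deterministic imperative model of computation
whose step count agrees with Turing machine time up to a polynomial. -/

/-- The data: binary trees (S-expressions over a single atom). -/
inductive BinTree : Type
  | nil : BinTree
  | cons : BinTree → BinTree → BinTree

namespace BinTree

def hd : BinTree → BinTree
  | nil => nil
  | cons a _ => a

def tl : BinTree → BinTree
  | nil => nil
  | cons _ b => b

/-- Number of nodes, leaves included. It is always positive. -/
def size : BinTree → ℕ
  | nil => 1
  | cons a b => a.size + b.size + 1

end BinTree

/-- A store assigns a tree to every program variable. -/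
abbrev Store : Type := ℕ → BinTree

inductive Exp : Type
  | var : ℕ → Exp
  | nil : Exp
  | cons : Exp → Exp → Exp
  | hd : Exp → Exp
  | tl : Exp → Exp

def Exp.eval (σ : Store) : Exp → BinTree
  | .var x => σ x
  | .nil => .nil
  | .cons e f => .cons (e.eval σ) (f.eval σ)
  | .hd e => (e.eval σ).hd
  | .tl e => (e.eval σ).tl

/-- Programs. A test succeeds if the value of its expression is not `nil`. -/
inductive Prog : Type
  | assign : ℕ → Exp → Prog
  | seq : Prog → Prog → Prog
  | ite : Exp → Prog → Prog → Prog
  | loop : Exp → Prog → Prog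

/-- `Exec P σ t σ'`: started in the store `σ`, the program `P` halts after `t` steps in the store
`σ'`. A step is one assignment or one evaluation of a test. (The expressions are part of the fixed
program, so that each of them costs a constant number of elementary tree operations.) -/
inductive Exec : Prog → Store → ℕ → Store → Prop
  | assign (x : ℕ) (e : Exp) (σ : Store) :
      Exec (.assign x e) σ 1 (Function.update σ x (e.eval σ))
  | seq {P Q : Prog} {σ σ₁ σ₂ : Store} {t u : ℕ} (h₁ : Exec P σ t σ₁) (h₂ : Exec Q σ₁ u σ₂) :
      Exec (.seq P Q) σ (t + u) σ₂
  | ite_true {e : Exp} {P Q : Prog} {σ σ₁ : Store} {t : ℕ} (he : e.eval σ ≠ .nil)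
      (h : Exec P σ t σ₁) : Exec (.ite e P Q) σ (t + 1) σ₁
  | ite_false {e : Exp} {P Q : Prog} {σ σ₁ : Store} {t : ℕ} (he : e.eval σ = .nil)
      (h : Exec Q σ t σ₁) : Exec (.ite e P Q) σ (t + 1) σ₁
  | loop_done {e : Exp} {P : Prog} {σ : Store} (he : e.eval σ = .nil) :
      Exec (.loop e P) σ 1 σ
  | loop_step {e : Exp} {P : Prog} {σ σ₁ σ₂ : Store} {t u : ℕ} (he : e.eval σ ≠ .nil)
      (h₁ : Exec P σ t σ₁) (h₂ : Exec (.loop e P) σ₁ u σ₂) :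
      Exec (.loop e P) σ (t + u + 1) σ₂

/-- Running time and final store are determined by the program and the initial store. -/
theorem Exec.deterministic {P : Prog} {σ σ₁ σ₂ : Store} {t₁ t₂ : ℕ}
    (h₁ : Exec P σ t₁ σ₁) (h₂ : Exec P σ t₂ σ₂) : t₁ = t₂ ∧ σ₁ = σ₂ := by
  induction h₁ generalizing t₂ σ₂ with
  | assign x e σ => cases h₂; exact ⟨rfl, rfl⟩
  | seq _ _ ih₁ ih₂ =>
    cases h₂ with
    | seq a b =>
      obtain ⟨rfl, rfl⟩ := ih₁ a
      obtain ⟨rfl, rfl⟩ := ih₂ b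
      exact ⟨rfl, rfl⟩
  | ite_true he _ ih =>
    cases h₂ with
    | ite_true _ a => obtain ⟨rfl, rfl⟩ := ih a; exact ⟨rfl, rfl⟩
    | ite_false he' _ => exact absurd he' he
  | ite_false he _ ih =>
    cases h₂ with
    | ite_true he' _ => exact absurd he he'
    | ite_false _ a => obtain ⟨rfl, rfl⟩ := ih a; exact ⟨rfl, rfl⟩
  | loop_done he =>
    cases h₂ with
    | loop_done _ => exact ⟨rfl, rfl⟩
    | loop_step he' _ _ => exact absurd he he'
  | loop_step he _ _ ih₁ ih₂ =>
    cases h₂ with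
    | loop_done he' => exact absurd he' he
    | loop_step _ a b =>
      obtain ⟨rfl, rfl⟩ := ih₁ a
      obtain ⟨rfl, rfl⟩ := ih₂ b
      exact ⟨rfl, rfl⟩

/-- The initial store: the input is in variable `0`, all other variables hold `nil`. -/
def initStore (input : BinTree) : Store := fun x => if x = 0 then input else .nil

/-- `P` halts on `input` within `T` steps, and the answer (acceptance means that variable `0`
finally differs from `nil`) is the truth value of `answer`. -/
def DecidesWithin (P : Prog) (input : BinTree) (answer : Prop) (T : ℕ) : Prop :=
  ∃ (t : ℕ) (σ : Store), Exec P (initStore input) t σ ∧ (σ 0 ≠ .nil ↔ answer) ∧ t ≤ T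

/-! ### Encodings -/

/-- Natural numbers in unary. -/
def encNat : ℕ → BinTree
  | 0 => .nil
  | k + 1 => .cons .nil (encNat k)

def encList {α : Type*} (enc : α → BinTree) : List α → BinTree
  | [] => .nil
  | a :: l => .cons (enc a) (encList enc l)

/-! ### Constraint satisfaction -/

/-- A constraint over the variables `Fin n` and the domain `Fin d`. The relation is a set of tuples,
given by a listing without repetitions. -/
structure Constraint (n d : ℕ) where
  scope : List (Fin n)
  rel : List (List (Fin d))
  scope_ne_nil : scope ≠ []
  scope_nodup : scope.Nodup
  rel_nodup : rel.Nodup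
  length_eq : ∀ r ∈ rel, r.length = scope.length

/-- Equality of constraints as pairs of a sequence of variables and a set of tuples. -/
def Constraint.Same {n d : ℕ} (C C' : Constraint n d) : Prop :=
  C.scope = C'.scope ∧ ∀ r, r ∈ C.rel ↔ r ∈ C'.rel

def Constraint.encode {n d : ℕ} (C : Constraint n d) : BinTree :=
  .cons (encList (fun x : Fin n => encNat x) C.scope)
    (encList (encList fun a : Fin d => encNat a) C.rel)

/-- A CSP instance with variable set `Fin vars` and domain `Fin dom`. The set of constraints is given
by a listing without repetitions; every variable occurs in a scope and every domain element
occurs in a relation. -/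
structure Instance where
  vars : ℕ
  dom : ℕ
  cons : List (Constraint vars dom)
  cons_distinct : cons.Pairwise fun C C' => ¬ C.Same C'
  var_occurs : ∀ x : Fin vars, ∃ C ∈ cons, x ∈ C.scope
  dom_occurs : ∀ a : Fin dom, ∃ C ∈ cons, ∃ r ∈ C.rel, a ∈ r

namespace Instance

/-- Some assignment of domain values to the variables satisfies all constraints. -/
def Consistent (I : Instance) : Prop :=
  ∃ τ : Fin I.vars → Fin I.dom, ∀ C ∈ I.cons, C.scope.map τ ∈ C.rel

def encode (I : Instance) : BinTree :=
  .cons (encNat I.vars) (.cons (encNat I.dom) (encList Constraint.encode I.cons))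

/-- The length of the input `I`. -/
def inputSize (I : Instance) : ℕ := I.encode.size

/-- The primal graph: two variables are adjacent if they occur together in a scope. -/
def primalGraph (I : Instance) : SimpleGraph (Fin I.vars) where
  Adj x y := x ≠ y ∧ ∃ C ∈ I.cons, x ∈ C.scope ∧ y ∈ C.scope
  symm := ⟨fun _ _ ⟨h, C, hC, hx, hy⟩ => ⟨h.symm, C, hC, hy, hx⟩⟩
  loopless := ⟨fun _ h => h.1 rfl⟩

end Instance

/-! ### Treewidth -/

/-- `bag` is a tree decomposition of `G` over the tree `T`. -/
structure IsTreeDecomposition {V : Type*} (G : SimpleGraph V) {m : ℕ} (T : SimpleGraph (Fin m))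
    (bag : Fin m → Finset V) : Prop where
  isTree : T.IsTree
  vertex : ∀ v, ∃ i, v ∈ bag i
  edge : ∀ u v, G.Adj u v → ∃ i, u ∈ bag i ∧ v ∈ bag i
  connected : ∀ v, (T.induce {i | v ∈ bag i}).Preconnected

/-- `G` has a tree decomposition of width at most `k`. -/
def HasTreewidthLE {V : Type*} (G : SimpleGraph V) (k : ℕ) : Prop :=
  ∃ (m : ℕ) (T : SimpleGraph (Fin m)) (bag : Fin m → Finset V),
    IsTreeDecomposition G T bag ∧ ∀ i, (bag i).card ≤ k + 1

/-- Minimum width of a tree decomposition (and `0` for the graph without vertices). -/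
noncomputable def treewidth {V : Type*} (G : SimpleGraph V) : ℕ := sInf {k | HasTreewidthLE G k}

/-- The minimum is taken over a nonempty set if the graph is finite. -/
theorem hasTreewidthLE_card {V : Type*} [Fintype V] (G : SimpleGraph V) :
    HasTreewidthLE G (Fintype.card V) := by
  refine ⟨1, ⊥, fun _ => Finset.univ, ⟨⟨⟨?_⟩, ?_⟩, ?_, ?_, ?_⟩, ?_⟩
  · intro a b
    rw [Subsingleton.elim a b]
  · exact SimpleGraph.isAcyclic_bot
  · exact fun v => ⟨0, Finset.mem_univ v⟩
  · exact fun u v _ => ⟨0, Finset.mem_univ u, Finset.mem_univ v⟩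
  · intro v a b
    rw [Subsingleton.elim a b]
  · intro i
    simp

/-- The treewidth of the primal graph. -/
noncomputable def Instance.tw (I : Instance) : ℕ := treewidth I.primalGraph

/-! ### Subexponential time -/

/-- The effective little-o: `f n ≤ g n / μ n` for all large `n`, where `μ` is computable,
nondecreasing and unbounded. -/
def LittleOEff (f g : ℕ → ℕ) : Prop :=
  Computable f ∧ Computable g ∧ ∃ μ : ℕ → ℕ, Computable μ ∧ Monotone μ ∧ (∀ b, ∃ n, b ≤ μ n) ∧
    ∃ n₀, ∀ n ≥ n₀, 0 < μ n ∧ (f n : ℝ) ≤ (g n : ℝ) / (μ n : ℝ)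

/-- `s n = Ω(n)`. -/
def IsOmegaLinear (s : ℕ → ℕ) : Prop :=
  ∃ c : ℝ, 0 < c ∧ ∃ n₀ : ℕ, ∀ n ≥ n₀, c * (n : ℝ) ≤ (s n : ℝ)

/-- CSP restricted to the instances in `K` is solvable in (uniform) subexponential time
`dom ^ o(n) * |I| ^ O(1)`: a single program decides consistency of all instances in `K` within this
time. For an empty domain, `dom` is replaced by `1` in the bound. -/
def SolvableInSubexpTime (K : Set Instance) : Prop :=
  ∃ (P : Prog) (f : ℕ → ℕ) (a b : ℕ), LittleOEff f (fun n => n) ∧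
    ∀ I ∈ K, DecidesWithin P I.encode I.Consistent
      (a * (max I.dom 1) ^ (f I.vars) * I.inputSize ^ b)

end CSPTime

/-! Part 1 rests on balanced separators. In a rooted tree decomposition with bags of size at most w,
take a deepest node t such that more than p of the remaining vertices have the top of their subtree
of bags below t. Delete the bag of t and detach these vertices. What lies below each child of t has
at most p vertices, and more than p vertices are used up. So at most w · ⌊n/(p+1)⌋ deletions leave
components of size at most p (`IsTreeDecomposition.exists_separator`).

If s = o(n) with rate μ, let u be about the eighth root of min(μ(n), n), and p = b = ⌊n/u²⌋. Then
the separator and all components have at most b elements, and there are only 2^O(n/u) sets of at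
most b variables (`LittleOEff.exists_bound`). Given a separator, one runs through its assignments
and extends each of them to the components independently (`solveWith_iff`). For dom ≥ 2 the total is
dom^O(n/u) · |I|^O(1). The program knows neither s nor the treewidth: it raises b until a separator
appears, and the parameters above serve only the analysis. For dom ≤ 1 the time bound has no
exponential factor, but there is at most one assignment, so all variables together serve as
separator.

The programs come from a calculus: `Ev C y` says that y is computable in time polynomial in a budget
B. It is closed under the usual list operations, a fold being allowed if its accumulators stay
polynomial (`Ev.foldl`). With the budget |I| · dom^g(n), where g = o(n), polynomial time is
subexponential time.

Part 2 is padding: k·n variables, of which only the first n carry real constraints, give treewidth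
at most n ≤ s(k·n) for a suitable constant k, and f(k·n) is still o(n). -/

namespace CSPTime

/-! ### Polynomial bounds -/

/-- `g` is bounded by a fixed power of `B + 2`. -/
def PolyBdd {ι : Type} (B g : ι → ℕ) : Prop := ∃ c, ∀ i, g i ≤ (B i + 2) ^ c

namespace PolyBdd

variable {ι : Type} {B g h : ι → ℕ}

theorem mono (hg : PolyBdd B g) (hh : ∀ i, h i ≤ g i) : PolyBdd B h :=
  hg.imp fun _ hc i => (hh i).trans (hc i)

theorem const (k : ℕ) : PolyBdd B fun _ => k :=
  ⟨k, fun i => Nat.lt_two_pow_self.le.trans (Nat.pow_le_pow_left (by omega) k)⟩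

theorem self : PolyBdd B B := ⟨1, fun i => by simp⟩

theorem mul (hg : PolyBdd B g) (hh : PolyBdd B h) : PolyBdd B fun i => g i * h i := by
  obtain ⟨c, hc⟩ := hg
  obtain ⟨d, hd⟩ := hh
  exact ⟨c + d, fun i => by rw [pow_add]; exact Nat.mul_le_mul (hc i) (hd i)⟩

theorem add (hg : PolyBdd B g) (hh : PolyBdd B h) : PolyBdd B fun i => g i + h i := by
  obtain ⟨c, hc⟩ := hg
  obtain ⟨d, hd⟩ := hh
  refine ⟨c + d + 1, fun i => ?_⟩
  have h1 : (B i + 2) ^ c ≤ (B i + 2) ^ (c + d) := Nat.pow_le_pow_right (by omega) (by omega)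
  have h2 : (B i + 2) ^ d ≤ (B i + 2) ^ (c + d) := Nat.pow_le_pow_right (by omega) (by omega)
  -- One more factor of at least 2 absorbs the doubling; this is what the shift by 2 in the base is
  -- for.
  have h3 : 2 * (B i + 2) ^ (c + d) ≤ (B i + 2) ^ (c + d + 1) := by
    rw [pow_succ, mul_comm]; exact Nat.mul_le_mul_left _ (by omega)
  have := hc i
  have := hd i
  dsimp only
  omega

theorem comp {κ : Type} (hg : PolyBdd B g) (φ : κ → ι) :
    PolyBdd (fun k => B (φ k)) fun k => g (φ k) :=
  hg.imp fun _ hc k => hc (φ k)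

end PolyBdd

/-! ### Encodings of data types -/

/-- Types with an encoding by trees. -/
class Enc (Y : Type) where
  enc : Y → BinTree

open Enc (enc)

instance : Enc Unit := ⟨fun _ => .nil⟩
instance : Enc Bool := ⟨fun b => cond b (.cons .nil .nil) .nil⟩
instance : Enc ℕ := ⟨encNat⟩
instance {Y : Type} [Enc Y] : Enc (List Y) := ⟨encList enc⟩
instance {Y Z : Type} [Enc Y] [Enc Z] : Enc (Y × Z) := ⟨fun p => .cons (enc p.1) (enc p.2)⟩

/-- The size of the encoding. -/
def esize {Y : Type} [Enc Y] (y : Y) : ℕ := (enc y).size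

section
variable {Y Z : Type} [Enc Y] [Enc Z]

theorem enc_nil : enc ([] : List Y) = .nil := rfl
theorem enc_cons (a : Y) (l : List Y) : enc (a :: l) = .cons (enc a) (enc l) := rfl
theorem enc_pair (p : Y × Z) : enc p = .cons (enc p.1) (enc p.2) := rfl
theorem enc_true : enc true = .cons .nil .nil := rfl
theorem enc_false : enc false = .nil := rfl
theorem enc_zero : enc 0 = .nil := rfl
theorem enc_succ (n : ℕ) : enc (n + 1) = .cons .nil (enc n) := rfl

/-- Unary numbers and lists of units are the same trees, so arithmetic reduces to list operations.
-/
theorem enc_replicate (n : ℕ) : enc (List.replicate n ()) = enc n := by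
  induction n with
  | zero => rfl
  | succ n ih => rw [List.replicate_succ, enc_cons, ih, enc_succ]; rfl

theorem BinTree.size_pos (t : BinTree) : 1 ≤ t.size := by
  cases t <;> simp [BinTree.size]

theorem esize_pos (y : Y) : 1 ≤ esize y := BinTree.size_pos _

theorem esize_nil : esize ([] : List Y) = 1 := rfl
theorem esize_cons (a : Y) (l : List Y) : esize (a :: l) = esize a + esize l + 1 := rfl
theorem esize_pair (p : Y × Z) : esize p = esize p.1 + esize p.2 + 1 := rfl

theorem esize_bool (b : Bool) : esize b ≤ 3 := by
  cases b <;> simp [esize, enc_true, enc_false, BinTree.size]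

theorem esize_nat (n : ℕ) : esize n = 2 * n + 1 := by
  induction n with
  | zero => rfl
  | succ n ih => rw [esize, enc_succ, BinTree.size, ← esize, ih, BinTree.size]; omega

theorem esize_append (l m : List Y) : esize (l ++ m) + 1 = esize l + esize m := by
  induction l with
  | nil => rw [List.nil_append, esize_nil]; omega
  | cons a l ih => rw [List.cons_append, esize_cons, esize_cons]; omega

theorem esize_le_of_mem {a : Y} {l : List Y} (h : a ∈ l) : esize a ≤ esize l := by
  induction l with
  | nil => cases h
  | cons b l ih =>
    rw [esize_cons]
    rcases List.mem_cons.1 h with rfl | h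
    · omega
    · have := ih h; omega

theorem length_le_esize (l : List Y) : l.length ≤ esize l := by
  induction l with
  | nil => simp
  | cons a l ih => rw [esize_cons, List.length_cons]; omega

theorem esize_le_of_forall {M : ℕ} {l : List Y} (h : ∀ a ∈ l, esize a ≤ M) :
    esize l ≤ l.length * (M + 1) + 1 := by
  induction l with
  | nil => simp [esize_nil]
  | cons a l ih =>
    have h1 := ih fun b hb => h b (List.mem_cons_of_mem _ hb)
    have h2 := h a List.mem_cons_self
    rw [esize_cons, List.length_cons, Nat.succ_mul]
    omega

theorem esize_le_of_prefix {l m : List Y} (h : l <+: m) : esize l ≤ esize m := by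
  obtain ⟨k, rfl⟩ := h
  have := esize_append l k
  have := esize_pos k
  omega

theorem esize_le_of_sublist {l m : List Y} (h : l.Sublist m) : esize l ≤ esize m := by
  induction h with
  | slnil => rfl
  | cons a _ ih => rw [esize_cons]; omega
  | cons_cons a _ ih => rw [esize_cons, esize_cons]; omega

end

/-! ### Hoare triples with time bounds -/

/-- Started in `σ`, the program `P` halts within `T` steps in a store with property `Q`. -/
def Runs (P : Prog) (σ : Store) (T : ℕ) (Q : Store → Prop) : Prop :=
  ∃ t σ', Exec P σ t σ' ∧ t ≤ T ∧ Q σ'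

namespace Runs

variable {P P' : Prog} {σ : Store} {T T' : ℕ} {Q Q' : Store → Prop}

theorem mono (h : Runs P σ T Q) (hT : T ≤ T') (hQ : ∀ σ', Q σ' → Q' σ') : Runs P σ T' Q' := by
  obtain ⟨t, σ', he, ht, hq⟩ := h
  exact ⟨t, σ', he, ht.trans hT, hQ _ hq⟩

theorem seq (h : Runs P σ T Q) (h' : ∀ σ', Q σ' → Runs P' σ' T' Q') :
    Runs (.seq P P') σ (T + T') Q' := by
  obtain ⟨t, σ', he, ht, hq⟩ := h
  obtain ⟨t', σ'', he', ht', hq'⟩ := h' σ' hq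
  exact ⟨t + t', σ'', .seq he he', by omega, hq'⟩

theorem assign {x : ℕ} {e : Exp} (h : Q (Function.update σ x (e.eval σ))) :
    Runs (.assign x e) σ 1 Q :=
  ⟨1, _, .assign x e σ, le_rfl, h⟩

theorem ite {e : Exp} (h : e.eval σ ≠ .nil → Runs P σ T Q) (h' : e.eval σ = .nil → Runs P' σ T Q) :
    Runs (.ite e P P') σ (T + 1) Q := by
  by_cases he : e.eval σ = .nil
  · obtain ⟨t, σ', hx, ht, hq⟩ := h' he
    exact ⟨t + 1, σ', .ite_false he hx, by omega, hq⟩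
  · obtain ⟨t, σ', hx, ht, hq⟩ := h he
    exact ⟨t + 1, σ', .ite_true he hx, by omega, hq⟩

end Runs

/-! ### Evaluation in a context -/

/-- A context: each index comes with a time budget and an input tree. -/
structure Ctx (ι : Type) where
  B : ι → ℕ
  x : ι → BinTree

/-- In the context `C`, the value `y` is computable in polynomial time: for each register `r`, there
is a program that replaces the input in register `r` by (the encoding of) `y` and
respects all lower registers. -/
def Ev {ι Y : Type} [Enc Y] (C : Ctx ι) (y : ι → Y) : Prop :=
  PolyBdd C.B (fun i => esize (y i)) ∧ ∃ T : ι → ℕ, PolyBdd C.B T ∧ ∀ r, ∃ P, ∀ i σ, σ r = C.x i →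
    Runs P σ (T i) fun σ' => σ' r = enc (y i) ∧ ∀ j < r, σ' j = σ j

/-- The context `C'` extends `C` along the map `φ` of indices. -/
structure Ext {ι κ : Type} (C : Ctx ι) (C' : Ctx κ) (φ : κ → ι) : Prop where
  B_eq : ∀ k, C'.B k = C.B (φ k)
  lift : ∀ {Y : Type} [Enc Y] {y : ι → Y}, Ev C y → Ev C' fun k => y (φ k)

/-! ### Basic closure properties of polynomial-time evaluation -/

namespace Ev

variable {ι : Type} {C : Ctx ι} {Y Z W : Type} [Enc Y] [Enc Z] [Enc W]

theorem congr_enc {y : ι → Y} {z : ι → Z} (h : Ev C y) (hz : ∀ i, enc (z i) = enc (y i)) :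
    Ev C z := by
  simpa only [Ev, esize, hz] using h

theorem congr {y z : ι → Y} (h : Ev C y) (hz : ∀ i, z i = y i) : Ev C z :=
  h.congr_enc fun i => by rw [hz]

theorem input {y : ι → Y} (hs : PolyBdd C.B fun i => esize (y i)) (h : ∀ i, C.x i = enc (y i)) :
    Ev C y :=
  ⟨hs, fun _ => 1, .const 1, fun r => ⟨.assign r (.var r), fun i σ hσ =>
    .assign ⟨by simp [Exp.eval, hσ, h], fun j hj => by simp [hj.ne]⟩⟩⟩

/-- An expression with the given value. -/
def _root_.CSPTime.BinTree.toExp : BinTree → Exp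
  | .nil => .nil
  | .cons a b => .cons a.toExp b.toExp

theorem _root_.CSPTime.BinTree.eval_toExp (t : BinTree) (σ : Store) : t.toExp.eval σ = t := by
  induction t with
  | nil => rfl
  | cons a b iha ihb => simp [BinTree.toExp, Exp.eval, iha, ihb]

theorem const (y : Y) : Ev C fun _ => y :=
  ⟨.const _, fun _ => 1, .const 1, fun r => ⟨.assign r (enc y).toExp, fun i σ _ =>
    .assign ⟨by simp [BinTree.eval_toExp], fun j hj => by simp [hj.ne]⟩⟩⟩

/-- Change of the index type. -/
theorem subst {κ : Type} {y : ι → Y} (h : Ev C y) (φ : κ → ι) :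
    Ev ⟨fun k => C.B (φ k), fun k => C.x (φ k)⟩ fun k => y (φ k) := by
  obtain ⟨hs, T, hT, hP⟩ := h
  refine ⟨hs.comp φ, fun k => T (φ k), hT.comp φ, fun r => ?_⟩
  obtain ⟨P, hP⟩ := hP r
  exact ⟨P, fun k σ hσ => hP (φ k) σ hσ⟩

theorem ext_subst {κ : Type} (φ : κ → ι) :
    Ext C ⟨fun k => C.B (φ k), fun k => C.x (φ k)⟩ φ :=
  ⟨fun _ => rfl, fun h => h.subst φ⟩

theorem size {y : ι → Y} (h : Ev C y) : PolyBdd C.B fun i => esize (y i) := h.1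

theorem unary {y : ι → Y} {z : ι → Z} (h : Ev C y) (e : Exp → Exp)
    (he : ∀ i r σ, σ r = enc (y i) → (e (.var r)).eval σ = enc (z i))
    (hs : ∀ i, esize (z i) ≤ esize (y i)) : Ev C z := by
  obtain ⟨hs', T, hT, hP⟩ := h
  refine ⟨hs'.mono hs, fun i => T i + 1, hT.add (.const 1), fun r => ?_⟩
  obtain ⟨P, hP⟩ := hP r
  refine ⟨.seq P (.assign r (e (.var r))), fun i σ hσ => (hP i σ hσ).seq fun σ' h' => .assign ?_⟩
  refine ⟨by simp [he i r σ' h'.1], fun j hj => by simp [hj.ne, h'.2 j hj]⟩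

theorem binary {y : ι → Y} {z : ι → Z} {w : ι → W} (hy : Ev C y) (hz : Ev C z)
    (hw : ∀ i, enc (w i) = .cons (enc (y i)) (enc (z i))) : Ev C w := by
  obtain ⟨hs, T, hT, hP⟩ := hy
  obtain ⟨hs', T', hT', hP'⟩ := hz
  refine ⟨((hs.add hs').add (.const 1)).mono fun i => ?_, fun i => 1 + (T i + (1 + (T' i + 1))),
    (PolyBdd.const 1).add (hT.add ((PolyBdd.const 1).add (hT'.add (.const 1)))), fun r => ?_⟩
  · simp only [esize, hw, BinTree.size]; rfl
  obtain ⟨P, hP⟩ := hP (r + 1)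
  obtain ⟨P', hP'⟩ := hP' (r + 2)
  -- The input stays in register `r` and is copied to `r + 1` and then to `r + 2`. As both programs
  -- respect lower registers, the input survives the first one and the first result survives the
  -- second one.
  refine ⟨.seq (.assign (r + 1) (.var r)) (.seq P (.seq (.assign (r + 2) (.var r)) (.seq P'
    (.assign r (.cons (.var (r + 1)) (.var (r + 2))))))), fun i σ hσ => ?_⟩
  refine Runs.seq (Q := fun σ' => σ' (r + 1) = C.x i ∧ ∀ j < r + 1, σ' j = σ j)
    (.assign ⟨by simp [Exp.eval, hσ], fun j hj => by simp [hj.ne]⟩) fun σ₁ h₁ => ?_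
  refine (hP i σ₁ h₁.1).seq fun σ₂ h₂ => ?_
  refine Runs.seq (Q := fun σ' => σ' (r + 2) = C.x i ∧ σ' (r + 1) = enc (y i) ∧
    ∀ j < r + 1, σ' j = σ j) (.assign ⟨?_, ?_, fun j hj => ?_⟩) fun σ₃ h₃ => ?_
  · simp [Exp.eval, h₂.2 r (by omega), h₁.2 r (by omega), hσ]
  · simp [h₂.1]
  · rw [Function.update_of_ne (by omega), h₂.2 j hj, h₁.2 j hj]
  refine (hP' i σ₃ h₃.1).seq fun σ₄ h₄ => .assign ⟨?_, fun j hj => ?_⟩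
  · simp [Exp.eval, h₄.1, h₄.2 (r + 1) (by omega), h₃.2.1, hw]
  · rw [Function.update_of_ne hj.ne, h₄.2 j (by omega), h₃.2.2 j (by omega)]

theorem pair {y : ι → Y} {z : ι → Z} (hy : Ev C y) (hz : Ev C z) : Ev C fun i => (y i, z i) :=
  hy.binary hz fun _ => rfl

theorem cons {y : ι → Y} {z : ι → List Y} (hy : Ev C y) (hz : Ev C z) : Ev C fun i => y i :: z i :=
  hy.binary hz fun _ => rfl

theorem succ {y : ι → ℕ} (hy : Ev C y) : Ev C fun i => y i + 1 :=
  (const ()).binary hy fun _ => rfl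

theorem fst {y : ι → Y × Z} (hy : Ev C y) : Ev C fun i => (y i).1 :=
  hy.unary .hd (fun i r σ h => by simp [Exp.eval, h, enc_pair, BinTree.hd])
    fun i => by rw [esize_pair]; omega

theorem snd {y : ι → Y × Z} (hy : Ev C y) : Ev C fun i => (y i).2 :=
  hy.unary .tl (fun i r σ h => by simp [Exp.eval, h, enc_pair, BinTree.tl])
    fun i => by rw [esize_pair]; omega

theorem tail {y : ι → List Y} (hy : Ev C y) : Ev C fun i => (y i).tail :=
  hy.unary .tl (fun i r σ h => by cases hl : y i <;> simp [Exp.eval, h, hl, enc_nil, enc_cons,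
    BinTree.tl]) fun i => esize_le_of_sublist (List.tail_sublist _)

theorem pred {y : ι → ℕ} (hy : Ev C y) : Ev C fun i => y i - 1 :=
  hy.unary .tl (fun i r σ h => by cases hl : y i <;> simp [Exp.eval, h, hl, enc_zero, enc_succ,
    BinTree.tl]) fun i => by simp only [esize_nat]; omega

theorem headD {y : ι → List ℕ} (hy : Ev C y) : Ev C fun i => (y i).headD 0 :=
  hy.unary .hd (fun i r σ h => by cases hl : y i <;> simp [Exp.eval, h, hl, enc_zero, enc_cons,
    enc_nil, BinTree.hd]) fun i => by
      cases hl : y i with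
      | nil => simp [esize_nat, esize_nil]
      | cons a l => rw [esize_cons, List.headD_cons]; omega

/-- Case distinction; a branch only has to be computable where it is taken. -/
theorem ite' {c : ι → Bool} {y : ι → Y} (hc : Ev C c)
    (ht : Ev (ι := {i // c i = true}) ⟨fun i => C.B i, fun i => C.x i⟩ fun i => y i)
    (hf : Ev (ι := {i // c i = false}) ⟨fun i => C.B i, fun i => C.x i⟩ fun i => y i) :
    Ev C y := by
  obtain ⟨-, T₀, hT₀, hP₀⟩ := hc
  obtain ⟨⟨c₁, hs₁⟩, T₁, ⟨k₁, hT₁⟩, hP₁⟩ := ht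
  obtain ⟨⟨c₂, hs₂⟩, T₂, ⟨k₂, hT₂⟩, hP₂⟩ := hf
  -- The bounds of the branches are only available on the two subtypes; the powers of `C.B i + 2`
  -- extend them to all indices.
  refine ⟨PolyBdd.mono (g := fun i => (C.B i + 2) ^ c₁ + (C.B i + 2) ^ c₂)
    (.add ⟨c₁, fun _ => le_rfl⟩ ⟨c₂, fun _ => le_rfl⟩) fun i => ?_,
    fun i => 1 + (T₀ i + ((1 + ((C.B i + 2) ^ k₁ + (C.B i + 2) ^ k₂) + 1) + 1)), ?_, fun r => ?_⟩
  · cases h : c i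
    · exact le_add_of_le_right (hs₂ ⟨i, h⟩)
    · exact le_add_of_le_left (hs₁ ⟨i, h⟩)
  · exact (PolyBdd.const 1).add (hT₀.add ((((PolyBdd.const 1).add
      (.add ⟨k₁, fun _ => le_rfl⟩ ⟨k₂, fun _ => le_rfl⟩)).add (.const 1)).add (.const 1)))
  obtain ⟨P₀, hP₀⟩ := hP₀ (r + 1)
  obtain ⟨P₁, hP₁⟩ := hP₁ r
  obtain ⟨P₂, hP₂⟩ := hP₂ r
  refine ⟨.seq (.assign (r + 1) (.var r)) (.seq P₀ (.ite (.var (r + 1)) P₁ P₂)), fun i σ hσ => ?_⟩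
  refine Runs.seq (Q := fun σ' => σ' (r + 1) = C.x i ∧ ∀ j < r + 1, σ' j = σ j)
    (.assign ⟨by simp [Exp.eval, hσ], fun j hj => by simp [hj.ne]⟩) fun σ₁ h₁ => ?_
  refine (hP₀ i σ₁ h₁.1).seq fun σ₂ h₂ => ?_
  have hr : σ₂ r = C.x i := by rw [h₂.2 r (by omega), h₁.2 r (by omega), hσ]
  have hlow : ∀ j < r, σ₂ j = σ j := fun j hj => by rw [h₂.2 j (by omega), h₁.2 j (by omega)]
  refine (Runs.ite (T := (C.B i + 2) ^ k₁ + (C.B i + 2) ^ k₂) (fun he => ?_) fun he => ?_).mono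
    (by omega) fun _ h => h
  · have h : c i = true := by
      by_contra h
      exact he (by simp [Exp.eval, h₂.1, h, enc_false])
    exact (hP₁ ⟨i, h⟩ σ₂ hr).mono ((hT₁ ⟨i, h⟩).trans (by simp)) fun σ' h' =>
      ⟨h'.1, fun j hj => by rw [h'.2 j hj, hlow j hj]⟩
  · have h : c i = false := by
      by_contra h
      rw [Bool.not_eq_false] at h
      simp [Exp.eval, h₂.1, h, enc_true] at he
    exact (hP₂ ⟨i, h⟩ σ₂ hr).mono ((hT₂ ⟨i, h⟩).trans (by simp)) fun σ' h' =>
      ⟨h'.1, fun j hj => by rw [h'.2 j hj, hlow j hj]⟩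

theorem ite {c : ι → Bool} {y z : ι → Y} (hc : Ev C c) (hy : Ev C y) (hz : Ev C z) :
    Ev C fun i => if c i then y i else z i :=
  hc.ite' ((hy.subst Subtype.val).congr fun i => by simp [i.2])
    ((hz.subst Subtype.val).congr fun i => by simp [i.2])

end Ev

/-- The loop of a fold: register `r` holds the input, `r + 1` the rest of the list and `r + 2` the
accumulator. -/
theorem Runs.foldl {β γ : Type} [Enc β] [Enc γ] {x : BinTree} {f : γ → β → γ} {g : γ}
    {l : List β} {r T : ℕ} {P : Prog}
    (hP : ∀ pre b σ, pre ++ [b] <+: l → σ (r + 3) = .cons x (enc (pre.foldl f g, b)) →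
      Runs P σ T fun σ' => σ' (r + 3) = enc (f (pre.foldl f g) b) ∧ ∀ j < r + 3, σ' j = σ j)
    (suf pre : List β) (hl : pre ++ suf = l) (σ : Store) (h₀ : σ r = x) (h₁ : σ (r + 1) = enc suf)
    (h₂ : σ (r + 2) = enc (pre.foldl f g)) :
    Runs (.loop (.var (r + 1))
      (.seq (.assign (r + 3) (.cons (.var r) (.cons (.var (r + 2)) (.hd (.var (r + 1))))))
        (.seq P (.seq (.assign (r + 2) (.var (r + 3))) (.assign (r + 1) (.tl (.var (r + 1))))))))
      σ (suf.length * (T + 4) + 1)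
      fun σ' => σ' (r + 2) = enc (l.foldl f g) ∧ ∀ j < r, σ' j = σ j := by
  induction suf generalizing pre σ with
  | nil =>
    rw [List.append_nil] at hl
    subst hl
    exact ⟨1, σ, .loop_done (by simp [Exp.eval, h₁, enc_nil]), by simp, h₂, fun _ _ => rfl⟩
  | cons b suf ih =>
    have body : Runs (.seq (.assign (r + 3) (.cons (.var r) (.cons (.var (r + 2)) (.hd (.var (r + 1))))))
        (.seq P (.seq (.assign (r + 2) (.var (r + 3))) (.assign (r + 1) (.tl (.var (r + 1)))))))
        σ (1 + (T + (1 + 1))) fun σ' => σ' (r + 1) = enc suf ∧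
          σ' (r + 2) = enc ((pre ++ [b]).foldl f g) ∧ ∀ j ≤ r, σ' j = σ j := by
      refine Runs.seq (Q := fun σ' => σ' (r + 3) = .cons x (enc (pre.foldl f g, b)) ∧
        ∀ j < r + 3, σ' j = σ j) (.assign ⟨?_, fun j hj => by simp [hj.ne]⟩) fun σ₁ k₁ => ?_
      · simp [Exp.eval, h₀, h₁, h₂, enc_cons, enc_pair, BinTree.hd]
      refine (hP pre b σ₁ ⟨suf, by simpa using hl⟩ k₁.1).seq fun σ₂ k₂ => ?_
      refine Runs.seq (Q := fun σ' => σ' (r + 2) = enc ((pre ++ [b]).foldl f g) ∧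
        ∀ j < r + 2, σ' j = σ j) (.assign ⟨?_, fun j hj => ?_⟩) fun σ₃ k₃ => .assign ⟨?_, ?_, ?_⟩
      · simp [Exp.eval, k₂.1]
      · rw [Function.update_of_ne hj.ne, k₂.2 j (by omega), k₁.2 j (by omega)]
      · simp [Exp.eval, k₃.2 (r + 1) (by omega), h₁, enc_cons, BinTree.tl]
      · rw [Function.update_of_ne (by omega), k₃.1]
      · intro j hj
        rw [Function.update_of_ne (by omega), k₃.2 j (by omega)]
    obtain ⟨t, σ₁, he, ht, k₁, k₂, k₃⟩ := body
    obtain ⟨u, σ₂, he', hu, k₄, k₅⟩ := ih (pre ++ [b]) (by simpa using hl) σ₁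
      (by rw [k₃ r le_rfl, h₀]) k₁ k₂
    refine ⟨t + u + 1, σ₂, .loop_step (by simp [Exp.eval, h₁, enc_cons]) he he', ?_, k₄,
      fun j hj => by rw [k₅ j hj, k₃ j hj.le]⟩
    rw [List.length_cons, Nat.succ_mul]
    omega

/-- The context with an additional value `z`. -/
def Ctx.extend {ι κ Z : Type} [Enc Z] (C : Ctx ι) (φ : κ → ι) (z : κ → Z) : Ctx κ :=
  ⟨fun k => C.B (φ k), fun k => .cons (C.x (φ k)) (enc (z k))⟩

theorem Ctx.ev_extend {ι κ Z : Type} [Enc Z] (C : Ctx ι) (φ : κ → ι) (z : κ → Z)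
    (h : PolyBdd (fun k => C.B (φ k)) fun k => esize (z k)) : Ev (C.extend φ z) z :=
  ⟨h, fun _ => 1, .const 1, fun r => ⟨.assign r (.tl (.var r)), fun k σ hσ => .assign
    ⟨by simp [Exp.eval, hσ, Ctx.extend, BinTree.tl], fun j hj => by simp [hj.ne]⟩⟩⟩

theorem Ctx.ext_extend {ι κ Z : Type} [Enc Z] (C : Ctx ι) (φ : κ → ι) (z : κ → Z) :
    Ext C (C.extend φ z) φ := by
  refine ⟨fun _ => rfl, fun {Y} _ y hy => ?_⟩
  obtain ⟨hs', T, hT, hP⟩ := hy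
  refine ⟨hs'.comp _, fun k => 1 + T (φ k), (PolyBdd.const 1).add (hT.comp _), fun r => ?_⟩
  obtain ⟨P, hP⟩ := hP r
  refine ⟨.seq (.assign r (.hd (.var r))) P, fun k σ hσ => ?_⟩
  refine Runs.seq (Q := fun σ' => σ' r = C.x (φ k) ∧ ∀ j < r, σ' j = σ j) (.assign ⟨?_, ?_⟩)
    fun σ₁ h₁ => (hP (φ k) σ₁ h₁.1).mono le_rfl fun σ' h' => ⟨h'.1, fun j hj => ?_⟩
  · simp [Exp.eval, hσ, Ctx.extend, BinTree.hd]
  · exact fun j hj => by simp [hj.ne]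
  · rw [h'.2 j hj, h₁.2 j hj]

/-- Iterating a polynomial-time body can produce exponentially large values, so a polynomial bound
on all intermediate accumulators is assumed. The body is only required to be computable on
accumulators that really occur, which allows facts about the processed prefix to be used in its
analysis. -/
theorem Ev.foldl {ι : Type} {C : Ctx ι} {β γ : Type} [Enc β] [Enc γ] {l : ι → List β} {g : ι → γ}
    {f : ι → γ → β → γ} (hl : Ev C l) (hg : Ev C g)
    (hs : ∃ c, ∀ i pre, pre <+: l i → esize (pre.foldl (f i) (g i)) ≤ (C.B i + 2) ^ c)
    (hf : ∀ (κ : Type) (C' : Ctx κ) (φ : κ → ι) (pre : κ → List β) (b : κ → β), Ext C C' φ →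
      Ev C' (fun k => (pre k).foldl (f (φ k)) (g (φ k))) → Ev C' b →
      (∀ k, pre k ++ [b k] <+: l (φ k)) →
      Ev C' fun k => f (φ k) ((pre k).foldl (f (φ k)) (g (φ k))) (b k)) :
    Ev C fun i => (l i).foldl (f i) (g i) := by
  obtain ⟨c, hs⟩ := hs
  -- The indices of the body are all the situations in which it is run: an input, a processed prefix
  -- and the next element. One program and one polynomial then serve all iterations.
  let κ := {p : ι × List β × β // p.2.1 ++ [p.2.2] <+: l p.1}
  have hsz : PolyBdd (fun k : κ => C.B k.1.1)
      fun k : κ => esize (k.1.2.1.foldl (f k.1.1) (g k.1.1)) :=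
    ⟨c, fun k => hs _ _ ((List.prefix_append _ _).trans k.2)⟩
  have hbz : PolyBdd (fun k : κ => C.B k.1.1) fun k : κ => esize k.1.2.2 :=
    (hl.size.comp fun k : κ => k.1.1).mono fun k =>
      esize_le_of_mem (k.2.subset (by simp))
  have hpair := C.ev_extend (fun k : κ => k.1.1)
    (fun k : κ => (k.1.2.1.foldl (f k.1.1) (g k.1.1), k.1.2.2))
    ((hsz.add (hbz.add (.const 1))).mono fun k => by rw [esize_pair]; dsimp only; omega)
  obtain ⟨-, T₃, ⟨k₃, hT₃⟩, hP₃⟩ := hf κ _ _ _ _ (C.ext_extend _ _) hpair.fst hpair.snd fun k => k.2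
  have hls := hl.size
  obtain ⟨-, T₁, hT₁, hP₁⟩ := hl
  obtain ⟨-, T₂, hT₂, hP₂⟩ := hg
  have hpow : PolyBdd C.B fun i => (C.B i + 2) ^ k₃ := ⟨k₃, fun _ => le_rfl⟩
  refine ⟨⟨c, fun i => hs i _ List.prefix_rfl⟩,
    fun i => 1 + (T₁ i + (1 + (T₂ i + ((esize (l i) * ((C.B i + 2) ^ k₃ + 4) + 1) + 1)))),
    (PolyBdd.const 1).add (hT₁.add ((PolyBdd.const 1).add (hT₂.add (((hls.mul (hpow.add
      (.const 4))).add (.const 1)).add (.const 1))))), fun r => ?_⟩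
  obtain ⟨P₁, hP₁⟩ := hP₁ (r + 1)
  obtain ⟨P₂, hP₂⟩ := hP₂ (r + 2)
  obtain ⟨P₃, hP₃⟩ := hP₃ (r + 3)
  refine ⟨.seq (.assign (r + 1) (.var r)) (.seq P₁ (.seq (.assign (r + 2) (.var r)) (.seq P₂ (.seq
    (.loop (.var (r + 1))
      (.seq (.assign (r + 3) (.cons (.var r) (.cons (.var (r + 2)) (.hd (.var (r + 1))))))
        (.seq P₃ (.seq (.assign (r + 2) (.var (r + 3))) (.assign (r + 1) (.tl (.var (r + 1))))))))
    (.assign r (.var (r + 2))))))), fun i σ hσ => ?_⟩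
  refine Runs.seq (Q := fun σ' => σ' (r + 1) = C.x i ∧ ∀ j < r + 1, σ' j = σ j)
    (.assign ⟨by simp [Exp.eval, hσ], fun j hj => by simp [hj.ne]⟩) fun σ₁ h₁ => ?_
  refine (hP₁ i σ₁ h₁.1).seq fun σ₂ h₂ => ?_
  refine Runs.seq (Q := fun σ' => σ' (r + 2) = C.x i ∧ σ' (r + 1) = enc (l i) ∧
    ∀ j < r + 1, σ' j = σ j) (.assign ⟨?_, ?_, fun j hj => ?_⟩) fun σ₃ h₃ => ?_
  · simp [Exp.eval, h₂.2 r (by omega), h₁.2 r (by omega), hσ]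
  · simp [h₂.1]
  · rw [Function.update_of_ne (by omega), h₂.2 j hj, h₁.2 j hj]
  refine (hP₂ i σ₃ h₃.1).seq fun σ₄ h₄ => ?_
  refine Runs.seq (Q := fun σ' => σ' (r + 2) = enc ((l i).foldl (f i) (g i)) ∧
    ∀ j < r, σ' j = σ j) ?_ fun σ₅ h₅ => .assign ⟨?_, fun j hj => ?_⟩
  · refine (Runs.foldl (x := C.x i) (T := (C.B i + 2) ^ k₃) (fun pre b σ' hpre hσ' => ?_) (l i) []
      (List.nil_append _) σ₄ ?_ ?_ h₄.1).mono ?_ fun σ' h' => ⟨h'.1, fun j hj => ?_⟩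
    · exact (hP₃ ⟨(i, pre, b), hpre⟩ σ' hσ').mono (hT₃ _) fun _ h => h
    · rw [h₄.2 r (by omega), h₃.2.2 r (by omega), hσ]
    · rw [h₄.2 (r + 1) (by omega), h₃.2.1]
    · exact Nat.add_le_add_right (Nat.mul_le_mul_right _ (length_le_esize _)) _
    · rw [h'.2 j hj, h₄.2 j (by omega), h₃.2.2 j (by omega)]
  · simp [Exp.eval, h₅.1]
  · rw [Function.update_of_ne hj.ne, h₅.2 j hj]

/-! ### Booleans, lists and unary arithmetic in polynomial time -/

namespace Ev

variable {ι : Type} {C : Ctx ι} {Y Z β γ : Type} [Enc Y] [Enc Z] [Enc β] [Enc γ]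

theorem not_nil {y : ι → Y} {c : ι → Bool} (h : Ev C y) (hc : ∀ i, c i = true ↔ enc (y i) ≠ .nil) :
    Ev C c := by
  obtain ⟨-, T, hT, hP⟩ := h
  refine ⟨(PolyBdd.const 3).mono fun i => esize_bool _, fun i => T i + (1 + 1),
    hT.add (.const 2), fun r => ?_⟩
  obtain ⟨P, hP⟩ := hP r
  refine ⟨.seq P (.ite (.var r) (.assign r (.cons .nil .nil)) (.assign r .nil)), fun i σ hσ =>
    (hP i σ hσ).seq fun σ' h' => Runs.ite (fun he => .assign ⟨?_, fun j hj => ?_⟩)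
      fun he => .assign ⟨?_, fun j hj => ?_⟩⟩
  · rw [Exp.eval, h'.1, ← hc] at he
    simp [he, Exp.eval, enc_true]
  · simp [hj.ne, h'.2 j hj]
  · rw [Exp.eval, h'.1] at he
    have : c i = false := by rw [← Bool.not_eq_true, hc]; simp [he]
    simp [this, Exp.eval, enc_false]
  · simp [hj.ne, h'.2 j hj]

theorem not {c : ι → Bool} (hc : Ev C c) : Ev C fun i => !c i :=
  (hc.ite (const false) (const true)).congr fun i => by cases c i <;> rfl

theorem and {c d : ι → Bool} (hc : Ev C c) (hd : Ev C d) : Ev C fun i => c i && d i :=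
  (hc.ite hd (const false)).congr fun i => by cases c i <;> rfl

theorem or {c d : ι → Bool} (hc : Ev C c) (hd : Ev C d) : Ev C fun i => c i || d i :=
  (hc.ite (const true) hd).congr fun i => by cases c i <;> rfl

theorem isEmpty {l : ι → List β} (hl : Ev C l) : Ev C fun i => (l i).isEmpty :=
  (hl.not_nil (c := fun i => !(l i).isEmpty) fun i => by
    cases l i <;> simp [enc_nil, enc_cons]).not.congr fun i => by simp

theorem eq_zero {m : ι → ℕ} (hm : Ev C m) : Ev C fun i => m i == 0 :=
  (hm.not_nil (c := fun i => !(m i == 0)) fun i => by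
    cases m i <;> simp [enc_zero, enc_succ]).not.congr fun i => by simp

theorem foldl_cons {l m : ι → List β} (hl : Ev C l) (hm : Ev C m) :
    Ev C fun i => (l i).foldl (fun acc b => b :: acc) (m i) := by
  have key : ∀ pre acc : List β, esize (pre.foldl (fun acc b => b :: acc) acc) + 1
      = esize pre + esize acc := by
    intro pre
    induction pre with
    | nil => intro acc; rw [esize_nil, List.foldl_nil]; omega
    | cons b pre ih => intro acc; rw [List.foldl_cons, ih, esize_cons, esize_cons]; omega
  refine hl.foldl hm ?_ fun κ C' φ pre b hE hacc hb _ => hb.cons hacc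
  obtain ⟨c, hc⟩ := hl.size.add hm.size
  refine ⟨c, fun i pre hpre => ?_⟩
  have := key pre (m i)
  have := esize_le_of_prefix hpre
  have := hc i
  dsimp only at this
  omega

theorem reverse {l : ι → List β} (hl : Ev C l) : Ev C fun i => (l i).reverse :=
  (hl.foldl_cons (const [])).congr fun i => by simp

theorem append {l m : ι → List β} (hl : Ev C l) (hm : Ev C m) : Ev C fun i => l i ++ m i :=
  (hl.reverse.foldl_cons hm).congr fun i => by simp

/-- Evaluation for all elements of a list, in polynomial time for each. -/
def Each (C : Ctx ι) (l : ι → List β) (f : ι → β → Y) : Prop :=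
  ∀ (κ : Type) (C' : Ctx κ) (φ : κ → ι) (b : κ → β), Ext C C' φ → Ev C' b →
    (∀ k, b k ∈ l (φ k)) → Ev C' fun k => f (φ k) (b k)

/-- Uniformity in the elements comes from applying the hypothesis once, in the context indexed by
all pairs of an input and an element of its list. -/
theorem Each.size {l : ι → List β} {f : ι → β → Y} (hl : Ev C l) (hf : Each C l f) :
    ∃ c, ∀ i, ∀ b ∈ l i, esize (f i b) ≤ (C.B i + 2) ^ c := by
  let κ := {p : ι × β // p.2 ∈ l p.1}
  have hb := C.ev_extend (fun k : κ => k.1.1) (fun k : κ => k.1.2)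
    ((hl.size.comp fun k : κ => k.1.1).mono fun k => esize_le_of_mem k.2)
  obtain ⟨c, hc⟩ := (hf κ _ _ _ (C.ext_extend _ _) hb fun k => k.2).size
  exact ⟨c, fun i b h => hc ⟨(i, b), h⟩⟩

/-- The source of `map` and `filter`, and through them of `any`, `all` and `length`. The
accumulators remain polynomial because each element contributes a piece of polynomial size. -/
theorem flatMap {l : ι → List β} {f : ι → β → List γ} (hl : Ev C l) (hf : Each C l f) :
    Ev C fun i => (l i).flatMap (f i) := by
  have key : ∀ i (pre : List β), pre.foldl (fun acc b => acc ++ f i b) [] = pre.flatMap (f i) := by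
    intro i pre
    induction pre using List.reverseRecOn with
    | nil => rfl
    | append_singleton pre b ih => simp [ih]
  refine (hl.foldl (const []) (f := fun i acc b => acc ++ f i b) ?_
    fun κ C' φ pre b hE hacc hb hpre => hacc.append (hf κ C' φ b hE hb fun k =>
      (hpre k).subset (by simp))).congr fun i => (key i _).symm
  obtain ⟨c, hc⟩ := hf.size hl
  obtain ⟨d, hd⟩ := (hl.size.mul (PolyBdd.add ⟨c, fun _ => le_rfl⟩ (.const 1))).add (.const 1)
  refine ⟨d, fun i pre hpre => (?_ : _ ≤ _).trans (hd i)⟩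
  rw [key]
  have h1 : ∀ pre : List β, (∀ b ∈ pre, esize (f i b) ≤ (C.B i + 2) ^ c) →
      esize (pre.flatMap (f i)) ≤ pre.length * ((C.B i + 2) ^ c + 1) + 1 := by
    intro pre
    induction pre with
    | nil => intro _; simp [esize_nil]
    | cons b pre ih =>
      intro h
      have := ih fun b' hb' => h b' (List.mem_cons_of_mem _ hb')
      have := h b List.mem_cons_self
      have := esize_append (f i b) (pre.flatMap (f i))
      rw [List.flatMap_cons, List.length_cons, Nat.succ_mul]
      omega
  refine (h1 pre fun b hb => hc i b (hpre.subset hb)).trans ?_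
  exact Nat.add_le_add_right (Nat.mul_le_mul_right _
    ((length_le_esize pre).trans (esize_le_of_prefix hpre))) _

theorem map {l : ι → List β} {f : ι → β → γ} (hl : Ev C l) (hf : Each C l f) :
    Ev C fun i => (l i).map (f i) :=
  (hl.flatMap (f := fun i b => [f i b]) fun κ C' φ b hE hb hm =>
    (hf κ C' φ b hE hb hm).cons (const [])).congr fun _ => List.map_eq_flatMap

theorem filter {l : ι → List β} {p : ι → β → Bool} (hl : Ev C l) (hp : Each C l p) :
    Ev C fun i => (l i).filter (p i) :=
  (hl.flatMap (f := fun i b => if p i b then [b] else []) fun κ C' φ b hE hb hm =>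
    (hp κ C' φ b hE hb hm).ite (hb.cons (const [])) (const [])).congr fun i => by
      induction l i with
      | nil => rfl
      | cons b l ih => rw [List.filter_cons, List.flatMap_cons, ih]; cases p i b <;> rfl

theorem any {l : ι → List β} {p : ι → β → Bool} (hl : Ev C l) (hp : Each C l p) :
    Ev C fun i => (l i).any (p i) :=
  (hl.filter hp).isEmpty.not.congr fun i => by
    induction l i with
    | nil => rfl
    | cons b l ih => rw [List.filter_cons, List.any_cons, ih]; cases p i b <;> simp

theorem all {l : ι → List β} {p : ι → β → Bool} (hl : Ev C l) (hp : Each C l p) :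
    Ev C fun i => (l i).all (p i) :=
  (hl.any (p := fun i b => !p i b) fun κ C' φ b hE hb hm =>
    (hp κ C' φ b hE hb hm).not).not.congr fun i => by
      induction l i with
      | nil => rfl
      | cons b l ih => rw [List.any_cons, List.all_cons, ih]; simp

/-- Conversion of numbers to lists. -/
theorem replicate {m : ι → ℕ} (hm : Ev C m) : Ev C fun i => List.replicate (m i) () :=
  hm.congr_enc fun _ => enc_replicate _

theorem length {l : ι → List β} (hl : Ev C l) : Ev C fun i => (l i).length :=
  (hl.map (f := fun _ _ => ()) fun _ _ _ _ _ _ _ => const ()).congr_enc fun i => by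
    rw [List.map_const', enc_replicate]

theorem add {m n : ι → ℕ} (hm : Ev C m) (hn : Ev C n) : Ev C fun i => m i + n i :=
  (hm.replicate.append hn.replicate).congr_enc fun i => by
    rw [List.replicate_append_replicate, enc_replicate]

theorem mul_const {m : ι → ℕ} (hm : Ev C m) (K : ℕ) : Ev C fun i => K * m i := by
  induction K with
  | zero => exact (const 0).congr fun i => by simp
  | succ K ih => exact (ih.add hm).congr fun i => by ring

theorem sub {m n : ι → ℕ} (hm : Ev C m) (hn : Ev C n) : Ev C fun i => m i - n i := by
  have key : ∀ i (pre : List Unit), pre.foldl (fun acc _ => acc - 1) (m i) = m i - pre.length := by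
    intro i pre
    induction pre using List.reverseRecOn with
    | nil => rfl
    | append_singleton pre b ih => simp [ih]; omega
  refine (hn.replicate.foldl hm (f := fun _ acc _ => acc - 1) ?_
    fun κ C' φ pre b hE hacc hb hpre => hacc.pred).congr fun i => by rw [key]; simp
  obtain ⟨c, hc⟩ := hm.size
  refine ⟨c, fun i pre hpre => le_trans ?_ (hc i)⟩
  dsimp only
  rw [key, esize_nat, esize_nat]
  omega

theorem le {m n : ι → ℕ} (hm : Ev C m) (hn : Ev C n) : Ev C fun i => decide (m i ≤ n i) :=
  (hm.sub hn).eq_zero.congr fun i => by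
    rw [Bool.eq_iff_iff]; simp [Nat.sub_eq_zero_iff_le]

theorem beq {m n : ι → ℕ} (hm : Ev C m) (hn : Ev C n) : Ev C fun i => m i == n i :=
  ((hm.le hn).and (hn.le hm)).congr fun i => by
    rw [Bool.eq_iff_iff]; simp; omega

theorem contains {l : ι → List ℕ} {m : ι → ℕ} (hl : Ev C l) (hm : Ev C m) :
    Ev C fun i => decide (m i ∈ l i) :=
  (hl.any (p := fun i b => m i == b) fun κ C' φ b hE hb _ => (hE.lift hm).beq hb).congr fun i => by
    rw [Bool.eq_iff_iff]; simp

theorem beq_list {l m : ι → List ℕ} (hl : Ev C l) (hm : Ev C m) :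
    Ev C fun i => l i == m i := by
  -- The state is the unread part of the second list together with the verdict so far. The emptiness
  -- test is needed since the head of an empty list defaults to `0`, which may equal `a`.
  let f : List ℕ × Bool → ℕ → List ℕ × Bool := fun s a =>
    (s.1.tail, s.2 && ((s.1.headD 0 == a) && !s.1.isEmpty))
  have key : ∀ (pre m : List ℕ) (c : Bool), (pre.foldl f (m, c)).1 = m.drop pre.length ∧
      (pre.foldl f (m, c)).2 = (c && (m.take pre.length == pre)) := by
    intro pre
    induction pre with
    | nil => intro m c; simp
    | cons a pre ih =>
      intro m c
      rw [List.foldl_cons]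
      cases m with
      | nil => rw [(ih _ _).1, (ih _ _).2]; simp
      | cons b m =>
        simp only [f, ih, List.tail_cons, List.headD_cons, List.length_cons, List.drop_succ_cons,
          List.take_succ_cons, List.isEmpty_cons, Bool.not_false, Bool.and_true, true_and]
        rw [Bool.eq_iff_iff]
        simp [and_assoc]
  have h : Ev C fun i => (l i).foldl f (m i, true) := by
    refine hl.foldl (f := fun _ => f) (hm.pair (const true)) ?_
      fun κ C' φ pre b hE hacc hb hpre => hacc.fst.tail.pair
        (hacc.snd.and ((hacc.fst.headD.beq hb).and hacc.fst.isEmpty.not))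
    obtain ⟨c, hc⟩ := hm.size.add (.const 4)
    refine ⟨c, fun i pre hpre => le_trans ?_ (hc i)⟩
    rw [esize_pair, (key _ _ _).1]
    have := esize_bool (pre.foldl f (m i, true)).2
    have := esize_le_of_sublist (List.drop_sublist pre.length (m i))
    dsimp only
    omega
  refine (h.snd.and h.fst.isEmpty).congr fun i => ?_
  rw [(key _ _ _).1, (key _ _ _).2, Bool.eq_iff_iff]
  simp only [beq_iff_eq, Bool.true_and, Bool.and_eq_true, List.isEmpty_iff, List.drop_eq_nil_iff]
  constructor
  · intro h; simp [h]
  · rintro ⟨h1, h2⟩; rw [← h1, List.take_of_length_le h2]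

theorem range {m : ι → ℕ} (hm : Ev C m) : Ev C fun i => List.range (m i) := by
  have key : ∀ pre : List Unit, pre.foldl (fun acc _ => acc ++ [acc.length]) []
      = List.range pre.length := by
    intro pre
    induction pre using List.reverseRecOn with
    | nil => rfl
    | append_singleton pre b ih => simp [ih, List.range_succ]
  refine (hm.replicate.foldl (const []) (f := fun _ acc _ => acc ++ [acc.length]) ?_
    fun κ C' φ pre b hE hacc hb hpre => hacc.append (hacc.length.cons (const []))).congr
      fun i => by rw [key]; simp
  obtain ⟨c, hc⟩ := (hm.size.mul (hm.size.add (.const 1))).add (.const 1)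
  refine ⟨c, fun i pre hpre => le_trans ?_ (hc i)⟩
  have hlen : pre.length ≤ m i := by simpa using hpre.length_le
  rw [key]
  refine (esize_le_of_forall (M := esize (m i)) fun a ha => ?_).trans ?_
  · rw [List.mem_range] at ha
    rw [esize_nat, esize_nat]; omega
  · rw [List.length_range]
    refine Nat.add_le_add_right (Nat.mul_le_mul_right _ ?_) _
    rw [esize_nat]; omega

end Ev

/-! ### The algorithm

Instances are given as a number `n` of variables, a domain size `d` and a list of constraints, each of
them a list of variables and a list of tuples. -/

/-- The sets of at most `b` variables below `n`. -/
def smallSets (n b : ℕ) : List (List ℕ) :=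
  (List.range n).foldl (fun L v => L ++ (L.filter fun S => decide (S.length + 1 ≤ b)).map fun S =>
    v :: S) [[]]

/-- The variables outside `S` that are in `Z` or adjacent to a variable in `Z`. -/
def expand (n : ℕ) (cs : List (List ℕ × List (List ℕ))) (S Z : List ℕ) : List ℕ :=
  (List.range n).filter fun y => decide (y ∈ Z) || (!decide (y ∈ S) && cs.any fun K =>
    decide (y ∈ K.1) && K.1.any fun z => decide (z ∈ Z))

/-- The connected component of `v` after the removal of `S`; empty if `v` is in `S`. -/
def component (n : ℕ) (cs : List (List ℕ × List (List ℕ))) (S : List ℕ) (v : ℕ) : List ℕ :=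
  (List.range (n + 1)).foldl (fun Z _ => expand n cs S Z)
    ((List.range n).filter fun y => (y == v) && !decide (y ∈ S))

/-- All components after the removal of `S` have at most `b` elements. -/
def separates (n : ℕ) (cs : List (List ℕ × List (List ℕ))) (b : ℕ) (S : List ℕ) : Bool :=
  (List.range n).all fun v => decide ((component n cs S v).length ≤ b)

/-- The separating sets of size `b` for the least possible `b < m`. For trivial domains, the set of all
variables is used instead. -/
def separatorsBelow (n d : ℕ) (cs : List (List ℕ × List (List ℕ))) (m : ℕ) : List (List ℕ) :=
  (List.range m).foldl (fun acc b => if acc.isEmpty then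
    (smallSets n b).filter (separates n cs b) else acc) (if decide (d ≤ 1) then [List.range n] else [])

def separators (n d : ℕ) (cs : List (List ℕ × List (List ℕ))) : List (List ℕ) :=
  separatorsBelow n d cs (n + 1)

/-- All assignments of values below `d` to the variables in `Z`. -/
def assignments (d : ℕ) (Z : List ℕ) : List (List (ℕ × ℕ)) :=
  Z.foldl (fun L x => L.flatMap fun α => (List.range d).map fun a => (x, a) :: α) [[]]

/-- The first entry for `x` counts, so that in `β ++ α` the values of `β` take precedence; without
an entry the value is `0`. -/
def value (α : List (ℕ × ℕ)) (x : ℕ) : ℕ := ((α.filter fun p => p.1 == x).map Prod.snd).headD 0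

/-- The constraint `K` is satisfied by `α` if all its variables are in `Z`. -/
def holdsOn (α : List (ℕ × ℕ)) (Z : List ℕ) (K : List ℕ × List (List ℕ)) : Bool :=
  (!K.1.all fun x => decide (x ∈ Z)) || K.2.any fun r => K.1.map (value α) == r

/-- Some assignment to `S` extends separately to each component. -/
def solveWith (n d : ℕ) (cs : List (List ℕ × List (List ℕ))) (S : List ℕ) : Bool :=
  (assignments d S).any fun α => (List.range n).all fun v =>
    (assignments d (component n cs S v)).any fun β => cs.all fun K =>
      holdsOn (β ++ α) (component n cs S v ++ S) K

/-- Every listed set gives the correct answer, so a single one would do; taking all of them costs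
only a factor within the budget. -/
def solve (n d : ℕ) (cs : List (List ℕ × List (List ℕ))) : Bool :=
  (separators n d cs).any fun S => solveWith n d cs S

/-! ### Basic properties of the algorithm -/

theorem smallSets_succ (n b : ℕ) : smallSets (n + 1) b = smallSets n b ++
    ((smallSets n b).filter fun S => decide (S.length + 1 ≤ b)).map fun S => n :: S := by
  rw [smallSets, List.range_succ, List.foldl_concat]; rfl

theorem mem_smallSets {n b : ℕ} {S : List ℕ} (h : S ∈ smallSets n b) :
    S.length ≤ b ∧ S.length ≤ n ∧ ∀ x ∈ S, x < n := by
  induction n generalizing S with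
  | zero => simp [smallSets] at h; subst h; simp
  | succ n ih =>
    rw [smallSets_succ, List.mem_append, List.mem_map] at h
    rcases h with h | ⟨S', h, rfl⟩
    · obtain ⟨h1, h2, h3⟩ := ih h
      exact ⟨h1, h2.trans n.le_succ, fun x hx => (h3 x hx).trans (Nat.lt_succ_self n)⟩
    · rw [List.mem_filter] at h
      obtain ⟨h1, h2, h3⟩ := ih h.1
      refine ⟨by simpa using h.2, by simpa using h2, fun x hx => ?_⟩
      rcases List.mem_cons.1 hx with rfl | hx
      · exact Nat.lt_succ_self _
      · exact (h3 x hx).trans (Nat.lt_succ_self n)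

theorem assignments_concat (d : ℕ) (Z : List ℕ) (x : ℕ) : assignments d (Z ++ [x]) =
    (assignments d Z).flatMap fun α => (List.range d).map fun a => (x, a) :: α := by
  rw [assignments, List.foldl_concat]; rfl

theorem mem_assignments_concat {d : ℕ} {Z : List ℕ} {x : ℕ} {α : List (ℕ × ℕ)} :
    α ∈ assignments d (Z ++ [x]) ↔ ∃ β ∈ assignments d Z, ∃ a < d, (x, a) :: β = α := by
  simp [assignments_concat]

theorem length_assignments (d : ℕ) (Z : List ℕ) :
    (assignments d Z).length = d ^ Z.length := by
  induction Z using List.reverseRecOn with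
  | nil => simp [assignments]
  | append_singleton Z x ih =>
    simp [assignments_concat, List.length_flatMap, ih, pow_succ]

theorem mem_assignments {d : ℕ} {Z : List ℕ} {α : List (ℕ × ℕ)} (h : α ∈ assignments d Z) :
    α.length = Z.length ∧ (∀ p ∈ α, p.1 ∈ Z ∧ p.2 < d) ∧ ∀ x ∈ Z, ∃ a, (x, a) ∈ α := by
  induction Z using List.reverseRecOn generalizing α with
  | nil => simp [assignments] at h; subst h; simp
  | append_singleton Z x ih =>
    obtain ⟨β, hβ, a, ha, rfl⟩ := mem_assignments_concat.1 h
    obtain ⟨h1, h2, h3⟩ := ih hβ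
    refine ⟨by simp [h1], fun p hp => ?_, fun y hy => ?_⟩
    · rcases List.mem_cons.1 hp with rfl | hp
      · simp [ha]
      · exact ⟨by simp [(h2 p hp).1], (h2 p hp).2⟩
    · rcases List.mem_append.1 hy with hy | hy
      · exact (h3 y hy).imp fun a ha => List.mem_cons_of_mem _ ha
      · exact ⟨a, by simp_all⟩

theorem exists_mem_assignments {d : ℕ} {Z : List ℕ} (τ : ℕ → ℕ) (h : ∀ x ∈ Z, τ x < d) :
    ∃ α ∈ assignments d Z, ∀ p ∈ α, p.2 = τ p.1 := by
  induction Z using List.reverseRecOn with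
  | nil => exact ⟨[], by simp [assignments], by simp⟩
  | append_singleton Z x ih =>
    obtain ⟨α, hα, h'⟩ := ih fun y hy => h y (List.mem_append_left _ hy)
    refine ⟨(x, τ x) :: α, mem_assignments_concat.2 ⟨α, hα, τ x, h x (by simp), rfl⟩, fun p hp => ?_⟩
    rcases List.mem_cons.1 hp with rfl | hp
    · rfl
    · exact h' p hp

/-- A separate bound `s` allows all prefixes of a list to be treated with the size of the whole
list. The base is `max d 1` because the bound has to increase with the length, which fails for
powers of `0`. -/
theorem esize_assignments_le (d : ℕ) {Z : List ℕ} {s : ℕ} (hs : esize Z ≤ s) :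
    esize (assignments d Z) ≤ (max d 1) ^ Z.length * (s * (s + (2 * d + 1) + 1 + 1) + 1 + 1) + 1 := by
  refine (esize_le_of_forall (M := s * (s + (2 * d + 1) + 1 + 1) + 1) fun α hα => ?_).trans ?_
  · obtain ⟨h1, h2, -⟩ := mem_assignments hα
    refine (esize_le_of_forall (M := s + (2 * d + 1) + 1) fun p hp => ?_).trans ?_
    · have := (esize_le_of_mem (h2 p hp).1).trans hs
      have := (h2 p hp).2
      rw [esize_pair, esize_nat p.2]
      omega
    · rw [h1]
      exact Nat.add_le_add_right (Nat.mul_le_mul_right _ ((length_le_esize _).trans hs)) _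
  · rw [length_assignments]
    exact Nat.add_le_add_right (Nat.mul_le_mul_right _ (Nat.pow_le_pow_left (by omega) _)) _

theorem prefix_range {pre : List ℕ} {n : ℕ} (h : pre <+: List.range n) :
    pre = List.range pre.length ∧ pre.length ≤ n := by
  have hl : pre.length ≤ n := by simpa using h.length_le
  refine ⟨?_, hl⟩
  rw [List.prefix_iff_eq_take.1 h, List.take_range]
  simp [hl]

/-- When a fold over a range reaches `b`, it has processed exactly the numbers below `b`; this
identifies its accumulator with `separatorsBelow` at stage `b`. -/
theorem prefix_range_concat {pre : List ℕ} {n b : ℕ} (h : pre ++ [b] <+: List.range n) :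
    pre = List.range b ∧ b < n := by
  have h1 := (prefix_range ((List.prefix_append pre [b]).trans h)).1
  obtain ⟨h2, h3⟩ := prefix_range h
  have hb : b = pre.length := by
    rw [List.length_append, List.length_singleton, List.range_succ, ← h1] at h2
    simpa using h2
  subst hb
  exact ⟨h1, by simpa using h3⟩

/-! ### Running time of the algorithm -/

namespace Ev

variable {ι : Type} {C : Ctx ι} {n d b v : ι → ℕ} {cs : ι → List (List ℕ × List (List ℕ))}
  {S Z : ι → List ℕ} {α : ι → List (ℕ × ℕ)} {K : ι → List ℕ × List (List ℕ)}

theorem smallSets (hn : Ev C n) (hb : Ev C b)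
    (hs : PolyBdd C.B fun i => (smallSets (n i) (b i)).length) :
    Ev C fun i => smallSets (n i) (b i) := by
  refine hn.range.foldl (const [[]]) (f := fun i L v => L ++ (L.filter fun S =>
    decide (S.length + 1 ≤ b i)).map fun S => v :: S) ?_ fun κ C' φ pre v hE hL hv _ =>
    hL.append ((hL.filter (p := fun k S => decide (S.length + 1 ≤ b (φ k)))
      fun κ' C'' ψ S hE' hS _ => hS.length.succ.le (hE'.lift (hE.lift hb))).map
        (f := fun k S => v k :: S) fun κ' C'' ψ S hE' hS _ => (hE'.lift hv).cons hS)
  obtain ⟨c, hc⟩ := (hs.mul (((hn.size.mul (hn.size.add (.const 1))).add (.const 1)).add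
    (.const 1))).add (.const 1)
  refine ⟨c, fun i pre hpre => le_trans ?_ (hc i)⟩
  obtain ⟨h1, h2⟩ := prefix_range hpre
  set m := pre.length
  -- The lists only grow during the construction, so the assumed bound on the final length covers
  -- all intermediate stages.
  have hmono : ∀ k, (CSPTime.smallSets m (b i)).length ≤ (CSPTime.smallSets (m + k) (b i)).length := by
    intro k
    induction k with
    | zero => rfl
    | succ k ih => rw [← add_assoc, smallSets_succ, List.length_append]; omega
  have hle := hmono (n i - m)
  rw [Nat.add_sub_of_le h2] at hle
  rw [h1]
  refine (esize_le_of_forall (l := CSPTime.smallSets m (b i))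
    (M := esize (n i) * (esize (n i) + 1) + 1) fun S hS => ?_).trans
    (Nat.add_le_add_right (Nat.mul_le_mul_right _ hle) _)
  obtain ⟨-, hlen, hlt⟩ := mem_smallSets hS
  refine (esize_le_of_forall (M := esize (n i)) fun x hx => ?_).trans
    (Nat.add_le_add_right (Nat.mul_le_mul_right _ ?_) _)
  · have := hlt x hx
    rw [esize_nat, esize_nat]; omega
  · rw [esize_nat]; omega

theorem expand (hn : Ev C n) (hcs : Ev C cs) (hS : Ev C S) (hZ : Ev C Z) :
    Ev C fun i => expand (n i) (cs i) (S i) (Z i) :=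
  hn.range.filter (p := fun i y => decide (y ∈ Z i) || (!decide (y ∈ S i) && (cs i).any fun K =>
    decide (y ∈ K.1) && K.1.any fun z => decide (z ∈ Z i))) fun _ _ φ y hE hy _ =>
    ((hE.lift hZ).contains hy).or (((hE.lift hS).contains hy).not.and
      ((hE.lift hcs).any (p := fun k K => decide (y k ∈ K.1) && K.1.any fun z => decide (z ∈ Z (φ k)))
        fun _ _ ψ _ hE' hK _ => (hK.fst.contains (hE'.lift hy)).and
          (hK.fst.any (p := fun k z => decide (z ∈ Z (φ (ψ k)))) fun _ _ _ _ hE'' hz _ =>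
            (hE''.lift (hE'.lift (hE.lift hZ))).contains hz)))

theorem component (hn : Ev C n) (hcs : Ev C cs) (hS : Ev C S) (hv : Ev C v) :
    Ev C fun i => component (n i) (cs i) (S i) (v i) := by
  refine hn.succ.range.foldl (f := fun i Z _ => CSPTime.expand (n i) (cs i) (S i) Z)
    (hn.range.filter (p := fun i y => (y == v i) && !decide (y ∈ S i)) fun κ C' φ y hE hy _ =>
      (hy.beq (hE.lift hv)).and ((hE.lift hS).contains hy).not) ?_ fun κ C' φ pre _ hE hZ _ _ =>
    (hE.lift hn).expand (hE.lift hcs) (hE.lift hS) hZ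
  obtain ⟨c, hc⟩ := hn.range.size
  refine ⟨c, fun i pre hpre => le_trans ?_ (hc i)⟩
  -- The start and every later iterate are filtered from the range below `n`.
  refine esize_le_of_sublist ?_
  cases pre using List.reverseRecOn with
  | nil => exact List.filter_sublist
  | append_singleton pre _ => rw [List.foldl_concat]; exact List.filter_sublist

theorem separates (hn : Ev C n) (hcs : Ev C cs) (hb : Ev C b) (hS : Ev C S) :
    Ev C fun i => separates (n i) (cs i) (b i) (S i) :=
  hn.range.all (p := fun i v => decide ((CSPTime.component (n i) (cs i) (S i) v).length ≤ b i))
    fun _ _ _ _ hE hv _ =>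
    ((hE.lift hn).component (hE.lift hcs) (hE.lift hS) hv).length.le (hE.lift hb)

theorem assignments (hd : Ev C d) (hZ : Ev C Z)
    (hs : PolyBdd C.B fun i => (max (d i) 1) ^ (Z i).length) :
    Ev C fun i => assignments (d i) (Z i) := by
  refine hZ.foldl (const [[]]) (f := fun i L x => L.flatMap fun α =>
    (List.range (d i)).map fun a => (x, a) :: α) ?_ fun κ C' φ pre x hE hL hx _ =>
    hL.flatMap (f := fun k α => (List.range (d (φ k))).map fun a => (x k, a) :: α)
      fun κ' C'' ψ α hE' hα _ => (hE'.lift (hE.lift hd)).range.map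
        (f := fun k a => (x (ψ k), a) :: α k) fun κ'' C₃ χ a hE'' ha _ =>
          ((hE''.lift (hE'.lift hx)).pair ha).cons (hE''.lift hα)
  obtain ⟨c, hc⟩ := (hs.mul (((hZ.size.mul (((hZ.size.add hd.size).add (.const 1)).add
    (.const 1))).add (.const 1)).add (.const 1))).add (.const 1)
  refine ⟨c, fun i pre hpre => le_trans ?_ (hc i)⟩
  refine (esize_assignments_le (d i) (esize_le_of_prefix hpre)).trans ?_
  rw [← esize_nat]
  exact Nat.add_le_add_right (Nat.mul_le_mul_right _
    (Nat.pow_le_pow_right (by omega) hpre.length_le)) _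

theorem value (hα : Ev C α) (hv : Ev C v) : Ev C fun i => value (α i) (v i) :=
  ((hα.filter (p := fun i (p : ℕ × ℕ) => p.1 == v i) fun _ _ _ _ hE hp _ => hp.fst.beq (hE.lift hv)).map
    (f := fun _ (p : ℕ × ℕ) => p.2) fun _ _ _ _ _ hp _ => hp.snd).headD

theorem holdsOn (hα : Ev C α) (hZ : Ev C Z) (hK : Ev C K) :
    Ev C fun i => holdsOn (α i) (Z i) (K i) :=
  (hK.fst.all (p := fun i x => decide (x ∈ Z i)) fun _ _ _ _ hE hx _ =>
    (hE.lift hZ).contains hx).not.or (hK.snd.any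
      (p := fun i r => (K i).1.map (CSPTime.value (α i)) == r) fun _ _ φ _ hE hr _ =>
        ((hE.lift hK).fst.map (f := fun k x => CSPTime.value (α (φ k)) x) fun _ _ _ _ hE' hx _ =>
          (hE'.lift (hE.lift hα)).value hx).beq_list hr)

/-- The only superpolynomial quantities are the numbers of assignments to `S` and to the single
components; these are what the two hypotheses place within the budget. -/
theorem solveWith (hn : Ev C n) (hd : Ev C d) (hcs : Ev C cs) (hS : Ev C S)
    (hs : PolyBdd C.B fun i => (max (d i) 1) ^ (S i).length)
    (hs' : ∃ c, ∀ i, ∀ v < n i,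
      (max (d i) 1) ^ (CSPTime.component (n i) (cs i) (S i) v).length ≤ (C.B i + 2) ^ c) :
    Ev C fun i => solveWith (n i) (d i) (cs i) (S i) := by
  refine (hd.assignments hS hs).any (p := fun i α => (List.range (n i)).all fun v =>
    (CSPTime.assignments (d i) (CSPTime.component (n i) (cs i) (S i) v)).any fun β =>
      (cs i).all fun K => CSPTime.holdsOn (β ++ α) (CSPTime.component (n i) (cs i) (S i) v ++ S i) K)
    fun κ₁ C₁ φ₁ α h₁ hα _ => ?_
  refine (h₁.lift hn).range.all (p := fun k v =>
    (CSPTime.assignments (d (φ₁ k)) (CSPTime.component (n (φ₁ k)) (cs (φ₁ k)) (S (φ₁ k)) v)).any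
      fun β => (cs (φ₁ k)).all fun K => CSPTime.holdsOn (β ++ α k)
        (CSPTime.component (n (φ₁ k)) (cs (φ₁ k)) (S (φ₁ k)) v ++ S (φ₁ k)) K)
    fun κ₂ C₂ φ₂ v h₂ hv hmem => ?_
  have hcomp := (h₂.lift (h₁.lift hn)).component (h₂.lift (h₁.lift hcs)) (h₂.lift (h₁.lift hS)) hv
  refine ((h₂.lift (h₁.lift hd)).assignments hcomp ?_).any (p := fun k β => (cs (φ₁ (φ₂ k))).all
    fun K => CSPTime.holdsOn (β ++ α (φ₂ k)) (CSPTime.component (n (φ₁ (φ₂ k))) (cs (φ₁ (φ₂ k)))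
      (S (φ₁ (φ₂ k))) (v k) ++ S (φ₁ (φ₂ k))) K) fun κ₃ C₃ φ₃ β h₃ hβ _ => ?_
  · obtain ⟨c, hc⟩ := hs'
    refine ⟨c, fun k => ?_⟩
    rw [h₂.B_eq, h₁.B_eq]
    exact hc _ _ (List.mem_range.1 (hmem k))
  · exact (h₃.lift (h₂.lift (h₁.lift hcs))).all fun κ₄ C₄ φ₄ K h₄ hK _ =>
      (h₄.lift (hβ.append (h₃.lift (h₂.lift hα)))).holdsOn
        (h₄.lift (h₃.lift (hcomp.append (h₂.lift (h₁.lift hS))))) hK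

/-- Small sets are listed only as long as no separator has been found. Hence their number has to be
bounded only for those `b` at which the search is still running. -/
theorem separators (hn : Ev C n) (hd : Ev C d) (hcs : Ev C cs)
    (hs : PolyBdd C.B fun i => esize (separators (n i) (d i) (cs i)))
    (hs' : ∃ c, ∀ i, ∀ b ≤ n i, separatorsBelow (n i) (d i) (cs i) b = [] →
      (CSPTime.smallSets (n i) b).length ≤ (C.B i + 2) ^ c) :
    Ev C fun i => separators (n i) (d i) (cs i) := by
  refine hn.succ.range.foldl (f := fun i acc b => if acc.isEmpty then
    (CSPTime.smallSets (n i) b).filter (CSPTime.separates (n i) (cs i) b) else acc)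
    ((hd.le (const 1)).ite (hn.range.cons (const [])) (const [])) ?_
    fun κ C' φ pre b hE hacc hb hmem => hacc.isEmpty.ite' ?_ ?_
  · obtain ⟨c, hc⟩ := hs
    refine ⟨c, fun i pre hpre => le_trans ?_ (hc i)⟩
    obtain ⟨suf, hsuf⟩ := hpre
    dsimp only [CSPTime.separators, separatorsBelow]
    rw [← hsuf, List.foldl_append]
    -- An accumulator is replaced only while it is empty, so sizes never decrease and the size of
    -- the final value bounds them all.
    have hfix : ∀ (l : List ℕ) (acc : List (List ℕ)), esize acc ≤ esize (l.foldl (fun acc b =>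
        if acc.isEmpty then (CSPTime.smallSets (n i) b).filter (CSPTime.separates (n i) (cs i) b)
        else acc) acc) := by
      intro l
      induction l with
      | nil => exact fun _ => le_rfl
      | cons b l ih =>
        intro acc
        refine le_trans ?_ (ih _)
        dsimp only
        split_ifs with h
        · rw [List.isEmpty_iff.1 h]; exact esize_pos _
        · exact le_rfl
    exact hfix suf _
  · let D := {k // ((pre k).foldl (fun acc b => if acc.isEmpty then
      (CSPTime.smallSets (n (φ k)) b).filter (CSPTime.separates (n (φ k)) (cs (φ k)) b) else acc)
        (if decide (d (φ k) ≤ 1) then [List.range (n (φ k))] else [])).isEmpty = true}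
    have hE' := ext_subst (C := C') fun k : D => k.1
    refine Ev.congr (((hE'.lift (hE.lift hn)).smallSets (hE'.lift hb) ?_).filter
      (p := fun k : D => CSPTime.separates (n (φ k.1)) (cs (φ k.1)) (b k.1)) fun _ _ _ _ h₂ hS _ =>
        (h₂.lift (hE'.lift (hE.lift hn))).separates (h₂.lift (hE'.lift (hE.lift hcs)))
          (h₂.lift (hE'.lift hb)) hS) fun k => if_pos k.2
    obtain ⟨c, hc⟩ := hs'
    refine ⟨c, fun k => ?_⟩
    rw [hE'.B_eq, hE.B_eq]
    obtain ⟨h1, h2⟩ := prefix_range_concat (hmem k)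
    exact hc _ _ (by omega) (by rw [separatorsBelow, ← h1]; exact List.isEmpty_iff.1 k.2)
  · exact (hacc.subst Subtype.val).congr fun k => if_neg (by rw [k.2]; simp)

end Ev

theorem separatorsBelow_succ (n d : ℕ) (cs : List (List ℕ × List (List ℕ))) (m : ℕ) :
    separatorsBelow n d cs (m + 1) = if separatorsBelow n d cs m = [] then
      (smallSets n m).filter (separates n cs m) else separatorsBelow n d cs m := by
  simp only [separatorsBelow, List.isEmpty_iff, List.range_succ, List.foldl_concat]

theorem separatorsBelow_eq_nil {n d : ℕ} {cs : List (List ℕ × List (List ℕ))} {m : ℕ}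
    (h : separatorsBelow n d cs m = []) :
    2 ≤ d ∧ ∀ b < m, ∀ S ∈ smallSets n b, separates n cs b S = false := by
  induction m with
  | zero =>
    refine ⟨?_, by simp⟩
    by_contra hd
    simp [separatorsBelow, show d ≤ 1 by omega] at h
  | succ m ih =>
    rw [separatorsBelow_succ] at h
    split_ifs at h with h'
    swap
    · exact absurd h h'
    obtain ⟨h1, h2⟩ := ih h'
    refine ⟨h1, fun b hb => ?_⟩
    rcases Nat.lt_succ_iff_lt_or_eq.1 hb with hb | rfl
    · exact h2 b hb
    · simpa using h

theorem separatorsBelow_cases (n d : ℕ) (cs : List (List ℕ × List (List ℕ))) (m : ℕ) :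
    (d ≤ 1 ∧ separatorsBelow n d cs m = [List.range n]) ∨ separatorsBelow n d cs m = [] ∨
      ∃ b < m, separatorsBelow n d cs b = [] ∧
        separatorsBelow n d cs m = (smallSets n b).filter (separates n cs b) := by
  induction m with
  | zero =>
    rcases Nat.lt_or_ge 1 d with h | h
    · exact .inr (.inl (by simp [separatorsBelow, show ¬ d ≤ 1 by omega]))
    · exact .inl ⟨h, by simp [separatorsBelow, h]⟩
  | succ m ih =>
    rw [separatorsBelow_succ]
    split_ifs with h
    · exact .inr (.inr ⟨m, m.lt_succ_self, h, rfl⟩)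
    · rcases ih with h' | h' | ⟨b, hb, h'⟩
      · exact .inl h'
      · exact absurd h' h
      · exact .inr (.inr ⟨b, by omega, h'⟩)

/-- The number `b` in `hB` is a witness for the analysis and is never computed: since a separator of
this size exists, the search stops no later than at `b`, and all sets and assignments listed by then
fit the budget. -/
theorem Ev.solve {ι : Type} {C : Ctx ι} {n d : ι → ℕ} {cs : ι → List (List ℕ × List (List ℕ))}
    (hn : Ev C n) (hd : Ev C d) (hcs : Ev C cs)
    (hB : ∃ c, ∀ i, 2 ≤ d i → ∃ b ≤ n i, (∃ S ∈ CSPTime.smallSets (n i) b,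
      CSPTime.separates (n i) (cs i) b S = true) ∧
      (∀ b' ≤ b, (CSPTime.smallSets (n i) b').length ≤ (C.B i + 2) ^ c) ∧
      d i ^ b ≤ (C.B i + 2) ^ c) :
    Ev C fun i => solve (n i) (d i) (cs i) := by
  obtain ⟨c, hB⟩ := hB
  have hpow : PolyBdd C.B fun i => (C.B i + 2) ^ c := ⟨c, fun _ => le_rfl⟩
  have hle : ∀ i b, separatorsBelow (n i) (d i) (cs i) b = [] → 2 ≤ d i ∧
      (CSPTime.smallSets (n i) b).length ≤ (C.B i + 2) ^ c ∧ d i ^ b ≤ (C.B i + 2) ^ c := by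
    intro i b h
    obtain ⟨h1, h2⟩ := separatorsBelow_eq_nil h
    obtain ⟨b₀, -, ⟨S, hS, hS'⟩, h3, h4⟩ := hB i h1
    -- A search that is still running at `b` has failed at all smaller sizes, whereas it succeeds at
    -- `b₀`.
    have hbb : b ≤ b₀ := by
      by_contra hlt
      rw [h2 b₀ (by omega) S hS] at hS'
      cases hS'
    exact ⟨h1, h3 b hbb, (Nat.pow_le_pow_right (by omega) hbb).trans h4⟩
  have hsep : Ev C fun i => CSPTime.separators (n i) (d i) (cs i) := by
    refine hn.separators hd hcs ?_ ⟨c, fun i b _ h => (hle i b h).2.1⟩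
    obtain ⟨k, hk⟩ := (hn.range.size.add (.const 2)).add ((hpow.mul (((hn.size.mul
      (hn.size.add (.const 1))).add (.const 1)).add (.const 1))).add (.const 1))
    refine ⟨k, fun i => le_trans ?_ (hk i)⟩
    dsimp only
    rw [CSPTime.separators]
    rcases separatorsBelow_cases (n i) (d i) (cs i) (n i + 1) with ⟨-, h⟩ | h | ⟨b, hb, h, h'⟩
    · rw [h, esize_cons, esize_nil]; omega
    · rw [h, esize_nil]; omega
    · rw [h']
      refine le_add_of_le_right ((esize_le_of_sublist List.filter_sublist).trans ?_)
      refine (esize_le_of_forall (M := esize (n i) * (esize (n i) + 1) + 1) fun S hS => ?_).trans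
        (Nat.add_le_add_right (Nat.mul_le_mul_right _ (hle i b h).2.1) _)
      obtain ⟨-, hlen, hlt⟩ := mem_smallSets hS
      refine (esize_le_of_forall (M := esize (n i)) fun x hx => ?_).trans
        (Nat.add_le_add_right (Nat.mul_le_mul_right _ ?_) _)
      · have := hlt x hx
        rw [esize_nat, esize_nat]; omega
      · rw [esize_nat]; omega
  have hsmall : ∀ i, ∀ S ∈ CSPTime.separators (n i) (d i) (cs i),
      (max (d i) 1) ^ S.length ≤ (C.B i + 2) ^ c ∧ ∀ v < n i,
        (max (d i) 1) ^ (CSPTime.component (n i) (cs i) S v).length ≤ (C.B i + 2) ^ c := by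
    intro i S hS
    rw [CSPTime.separators] at hS
    rcases separatorsBelow_cases (n i) (d i) (cs i) (n i + 1) with ⟨h, -⟩ | h | ⟨b, hb, h, h'⟩
    -- For a trivial domain the base is `1`, so using all variables as separator is harmless.
    · rw [max_eq_right h]
      simp only [one_pow]
      exact ⟨Nat.one_le_pow _ _ (by omega), fun _ _ => Nat.one_le_pow _ _ (by omega)⟩
    · rw [h] at hS; cases hS
    · rw [h', List.mem_filter, CSPTime.separates, List.all_eq_true] at hS
      obtain ⟨h1, -, h3⟩ := hle i b h
      rw [max_eq_left (by omega)]
      exact ⟨(Nat.pow_le_pow_right (by omega) (mem_smallSets hS.1).1).trans h3, fun v hv =>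
        (Nat.pow_le_pow_right (by omega) (by simpa using hS.2 v (List.mem_range.2 hv))).trans h3⟩
  refine hsep.any (p := fun i S => CSPTime.solveWith (n i) (d i) (cs i) S) fun κ C' φ S hE hS hmem =>
    (hE.lift hn).solveWith (hE.lift hd) (hE.lift hcs) hS ⟨c, fun k => ?_⟩ ⟨c, fun k => ?_⟩
  · rw [hE.B_eq]; exact (hsmall _ _ (hmem k)).1
  · rw [hE.B_eq]; exact (hsmall _ _ (hmem k)).2

/-! ### Components -/

section
variable {n : ℕ} {cs : List (List ℕ × List (List ℕ))} {S : List ℕ} {v w : ℕ}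

theorem mem_expand {Z : List ℕ} {y : ℕ} : y ∈ expand n cs S Z ↔
    y < n ∧ (y ∈ Z ∨ y ∉ S ∧ ∃ K ∈ cs, y ∈ K.1 ∧ ∃ z ∈ K.1, z ∈ Z) := by
  simp [expand]

theorem component_eq_iterate : component n cs S v = (expand n cs S)^[n + 1]
    ((List.range n).filter fun y => (y == v) && !decide (y ∈ S)) := by
  rw [component]
  generalize n + 1 = m
  induction m with
  | zero => rfl
  | succ m ih => rw [List.range_succ, List.foldl_concat, Function.iterate_succ_apply', ih]

/-- An iteration that has not become stationary has gained an element in each step. With only `n`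
candidates, it must be stationary after `n + 1` steps. -/
theorem iterate_expand_aux (m : ℕ) (Z : List ℕ) (hZ : ∃ p, Z = (List.range n).filter p) :
    (∃ p, (expand n cs S)^[m] Z = (List.range n).filter p) ∧
      (expand n cs S ((expand n cs S)^[m] Z) = (expand n cs S)^[m] Z ∨
        m ≤ ((expand n cs S)^[m] Z).length) := by
  induction m with
  | zero => exact ⟨hZ, .inr (Nat.zero_le _)⟩
  | succ m ih =>
    rw [Function.iterate_succ_apply']
    obtain ⟨⟨p, hp⟩, ih⟩ := ih
    refine ⟨⟨_, rfl⟩, ?_⟩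
    rcases ih with ih | ih
    · exact .inl (by rw [ih, ih])
    · have hsub : ((expand n cs S)^[m] Z).Sublist (expand n cs S ((expand n cs S)^[m] Z)) := by
        -- Written as a filter of the range by its own membership test, the iterate is visibly a
        -- sublist of its expansion; for sublists, equal length means equality.
        have hp' : (expand n cs S)^[m] Z = (List.range n).filter fun y =>
            decide (y ∈ (expand n cs S)^[m] Z) := by
          conv_lhs => rw [hp]
          refine List.filter_congr fun y hy => ?_
          rw [hp, Bool.eq_iff_iff, decide_eq_true_eq, List.mem_filter]
          exact ⟨fun h => ⟨hy, h⟩, fun h => h.2⟩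
        conv_lhs => rw [hp']
        exact List.monotone_filter_right _ fun y hy => by simp [of_decide_eq_true hy]
      rcases hsub.length_le.lt_or_eq with h | h
      · exact .inr (by omega)
      · have := hsub.eq_of_length h
        exact .inl (by rw [← this, ← this])

theorem expand_component : expand n cs S (component n cs S v) = component n cs S v := by
  rw [component_eq_iterate]
  obtain ⟨⟨p, hp⟩, h | h⟩ := iterate_expand_aux (cs := cs) (S := S) (n + 1)
    ((List.range n).filter fun y => (y == v) && !decide (y ∈ S)) ⟨_, rfl⟩
  · exact h
  · have h' := (List.length_filter_le p (List.range n))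
    rw [← hp, List.length_range] at h'
    omega

theorem lt_of_mem_component {x : ℕ} (h : x ∈ component n cs S v) : x < n := by
  rw [← expand_component] at h
  exact (mem_expand.1 h).1

theorem component_closed {x y : ℕ} {K : List ℕ × List (List ℕ)} (hx : x ∈ component n cs S v)
    (hy : y < n) (hS : y ∉ S) (hK : K ∈ cs) (hxK : x ∈ K.1) (hyK : y ∈ K.1) :
    y ∈ component n cs S v := by
  rw [← expand_component]
  exact mem_expand.2 ⟨hy, .inr ⟨hS, K, hK, hyK, x, hxK, hx⟩⟩

/-- A component is contained in each set that is closed under adjacency outside `S`. -/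
theorem component_subset {X : Set ℕ} (hv : v < n → v ∉ S → v ∈ X)
    (hX : ∀ x ∈ X, ∀ y < n, y ∉ S → ∀ K ∈ cs, x ∈ K.1 → y ∈ K.1 → y ∈ X) {x : ℕ}
    (hx : x ∈ component n cs S v) : x ∈ X := by
  rw [component_eq_iterate] at hx
  generalize n + 1 = m at hx
  induction m generalizing x with
  | zero =>
    simp only [Function.iterate_zero, id_eq, List.mem_filter, List.mem_range, Bool.and_eq_true,
      beq_iff_eq, Bool.not_eq_true', decide_eq_false_iff_not] at hx
    obtain ⟨h1, rfl, h2⟩ := hx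
    exact hv h1 h2
  | succ m ih =>
    rw [Function.iterate_succ_apply', mem_expand] at hx
    obtain ⟨hxn, h | ⟨hxS, K, hK, hxK, z, hzK, hz⟩⟩ := hx
    · exact ih h
    · exact hX z (ih hz) x hxn hxS K hK hzK hxK

theorem notMem_of_mem_component {x : ℕ} (h : x ∈ component n cs S v) : x ∉ S :=
  component_subset (X := {x | x ∉ S}) (fun _ h => h) (fun _ _ _ _ h _ _ _ _ => h) h

theorem mem_component_self (hv : v < n) (hS : v ∉ S) : v ∈ component n cs S v := by
  rw [component_eq_iterate]
  generalize n + 1 = m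
  induction m with
  | zero => simp [hv, hS]
  | succ m ih =>
    rw [Function.iterate_succ_apply', mem_expand]
    exact ⟨hv, .inl ih⟩

/-- The equality holds for lists, not just for sets, as both sides are fixed by `expand` and hence
filtered from the same range. This allows assignments to be indexed by the component itself. -/
theorem component_eq {K : List ℕ × List (List ℕ)} (hv : v < n) (hw : w < n) (hvS : v ∉ S)
    (hwS : w ∉ S) (hK : K ∈ cs) (hvK : v ∈ K.1) (hwK : w ∈ K.1) :
    component n cs S v = component n cs S w := by
  have hsub : ∀ {a b : ℕ}, a < n → b < n → a ∉ S → b ∉ S → a ∈ K.1 → b ∈ K.1 →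
      ∀ x ∈ component n cs S a, x ∈ component n cs S b := fun ha hb haS hbS haK hbK x hx =>
    component_subset (X := {x | x ∈ component n cs S _})
      (fun _ _ => component_closed (mem_component_self hb hbS) ha haS hK hbK haK)
      (fun x hx y hy hyS K' hK' hxK' hyK' => component_closed hx hy hyS hK' hxK' hyK') hx
  have hmem : ∀ x, x ∈ component n cs S v ↔ x ∈ component n cs S w := fun x =>
    ⟨hsub hv hw hvS hwS hvK hwK x, hsub hw hv hwS hvS hwK hvK x⟩
  rw [← expand_component (v := v), ← expand_component (v := w), expand, expand]
  exact List.filter_congr fun y _ => by simp only [hmem]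

end

/-! ### Correctness of the algorithm -/

theorem value_mem {α : List (ℕ × ℕ)} {x : ℕ} (h : ∃ a, (x, a) ∈ α) : (x, value α x) ∈ α := by
  obtain ⟨a, ha⟩ := h
  rw [value]
  have hm : (x, a) ∈ α.filter fun p => p.1 == x := List.mem_filter.2 ⟨ha, by simp⟩
  cases hl : α.filter fun p => p.1 == x with
  | nil => rw [hl] at hm; cases hm
  | cons p l =>
    have hp : p ∈ α.filter fun p => p.1 == x := by rw [hl]; exact List.mem_cons_self
    rw [List.mem_filter, beq_iff_eq] at hp
    obtain ⟨hp, rfl⟩ := hp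
    exact hp

theorem value_append_of_mem {α β : List (ℕ × ℕ)} {x : ℕ} (h : ∃ a, (x, a) ∈ β) :
    value (β ++ α) x = value β x := by
  obtain ⟨a, ha⟩ := h
  have hm : (x, a) ∈ β.filter fun p => p.1 == x := List.mem_filter.2 ⟨ha, by simp⟩
  rw [value, value, List.filter_append]
  cases hl : β.filter fun p => p.1 == x with
  | nil => rw [hl] at hm; cases hm
  | cons p l => rfl

theorem value_append_of_notMem {α β : List (ℕ × ℕ)} {x : ℕ} (h : ∀ p ∈ β, p.1 ≠ x) :
    value (β ++ α) x = value α x := by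
  rw [value, value, List.filter_append, List.filter_eq_nil_iff.2 (by simpa using h)]
  rfl

theorem holdsOn_iff {α : List (ℕ × ℕ)} {Z : List ℕ} {K : List ℕ × List (List ℕ)} :
    holdsOn α Z K = true ↔ ((∀ x ∈ K.1, x ∈ Z) → K.1.map (value α) ∈ K.2) := by
  simp [holdsOn, imp_iff_not_or]

/-- The variables of a scope that lie outside `S` are pairwise adjacent, hence in one component. So
each constraint only sees `S` and one component, and extensions chosen independently fit together.
-/
theorem solveWith_iff {n d : ℕ} {cs : List (List ℕ × List (List ℕ))} {S : List ℕ}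
    (hcs : ∀ K ∈ cs, K.1 ≠ [] ∧ ∀ x ∈ K.1, x < n) (hS : ∀ x ∈ S, x < n) :
    solveWith n d cs S = true ↔
      ∃ τ : ℕ → ℕ, (∀ x < n, τ x < d) ∧ ∀ K ∈ cs, K.1.map τ ∈ K.2 := by
  simp only [solveWith, List.any_eq_true, List.all_eq_true, List.mem_range, holdsOn_iff]
  constructor
  · rintro ⟨α, hα, h⟩
    -- The extension is chosen for each component, not for each variable `v`, so that variables of
    -- the same component use the same one.
    have h' : ∀ Z : List ℕ, ∃ β, ∀ v < n, component n cs S v = Z → β ∈ assignments d Z ∧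
        ∀ K ∈ cs, (∀ x ∈ K.1, x ∈ Z ++ S) → K.1.map (value (β ++ α)) ∈ K.2 := by
      intro Z
      by_cases hZ : ∃ v < n, component n cs S v = Z
      · obtain ⟨v, hv, rfl⟩ := hZ
        obtain ⟨β, hβ⟩ := h v hv
        exact ⟨β, fun _ _ _ => hβ⟩
      · exact ⟨[], fun v hv h => absurd ⟨v, hv, h⟩ hZ⟩
    choose β hβ using h'
    have hα' := mem_assignments hα
    have hβ' := fun v hv => mem_assignments (hβ (component n cs S v) v hv rfl).1
    have hτ : ∀ v < n, ∀ x < n, (x ∈ S ∨ component n cs S x = component n cs S v) →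
        (if x ∈ S then value α x else value (β (component n cs S x)) x) =
          value (β (component n cs S v) ++ α) x := by
      intro v hv x hx hxv
      split_ifs with hxS
      · refine (value_append_of_notMem fun p hp hpx => ?_).symm
        have := ((hβ' v hv).2.1 p hp).1
        rw [hpx] at this
        exact notMem_of_mem_component this hxS
      · have hxv := hxv.resolve_left hxS
        rw [hxv]
        refine (value_append_of_mem ((hβ' v hv).2.2 x ?_)).symm
        rw [← hxv]
        exact mem_component_self hx hxS
    refine ⟨fun x => if x ∈ S then value α x else value (β (component n cs S x)) x,
      fun x hx => ?_, fun K hK => ?_⟩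
    · dsimp only
      split_ifs with hxS
      · exact (hα'.2.1 _ (value_mem (hα'.2.2 x hxS))).2
      · exact ((hβ' x hx).2.1 _ (value_mem ((hβ' x hx).2.2 x (mem_component_self hx hxS)))).2
    · obtain ⟨hne, hlt⟩ := hcs K hK
      have key : ∀ v < n, (∀ x ∈ K.1, x ∈ S ∨ component n cs S x = component n cs S v) →
          K.1.map (fun x => if x ∈ S then value α x else value (β (component n cs S x)) x) ∈ K.2 := by
        intro v hv hKv
        rw [List.map_congr_left fun x hx => hτ v hv x (hlt x hx) (hKv x hx)]
        refine (hβ _ v hv rfl).2 K hK fun x hx => ?_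
        rw [List.mem_append]
        by_cases hxS : x ∈ S
        · exact .inr hxS
        · left
          rw [← (hKv x hx).resolve_left hxS]
          exact mem_component_self (hlt x hx) hxS
      -- A constraint inside `S` is tested along with every component; that there is at least one `v
      -- < n` to test follows from the scope being non-empty.
      by_cases hKS : ∀ x ∈ K.1, x ∈ S
      · obtain ⟨v, hv⟩ := List.exists_mem_of_ne_nil _ hne
        exact key v (hlt v hv) fun x hx => .inl (hKS x hx)
      · push Not at hKS
        obtain ⟨v, hv, hvS⟩ := hKS
        exact key v (hlt v hv) fun x hx => or_iff_not_imp_left.2 fun hxS =>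
          component_eq (hlt x hx) (hlt v hv) hxS hvS hK hx hv
  · rintro ⟨τ, hτ, h⟩
    obtain ⟨α, hα, hα'⟩ := exists_mem_assignments τ fun x hx => hτ x (hS x hx)
    refine ⟨α, hα, fun v hv => ?_⟩
    obtain ⟨β, hβ, hβ'⟩ := exists_mem_assignments τ fun x hx =>
      hτ x (lt_of_mem_component (cs := cs) (S := S) (v := v) hx)
    refine ⟨β, hβ, fun K hK hKZ => ?_⟩
    rw [List.map_congr_left (g := τ)]
    · exact h K hK
    · intro x hx
      have : (x, value (β ++ α) x) ∈ β ++ α := by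
        refine value_mem ?_
        rcases List.mem_append.1 (hKZ x hx) with hx | hx
        · exact ((mem_assignments hβ).2.2 x hx).imp fun a ha => List.mem_append_left _ ha
        · exact ((mem_assignments hα).2.2 x hx).imp fun a ha => List.mem_append_right _ ha
      rcases List.mem_append.1 this with h | h
      · exact hβ' _ h
      · exact hα' _ h

theorem solve_iff {n d : ℕ} {cs : List (List ℕ × List (List ℕ))}
    (hcs : ∀ K ∈ cs, K.1 ≠ [] ∧ ∀ x ∈ K.1, x < n)
    (hB : 2 ≤ d → ∃ b ≤ n, ∃ S ∈ smallSets n b, separates n cs b S = true) :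
    solve n d cs = true ↔ ∃ τ : ℕ → ℕ, (∀ x < n, τ x < d) ∧ ∀ K ∈ cs, K.1.map τ ∈ K.2 := by
  have hlt : ∀ S ∈ separators n d cs, ∀ x ∈ S, x < n := by
    intro S hS
    rw [separators] at hS
    rcases separatorsBelow_cases n d cs (n + 1) with ⟨-, h⟩ | h | ⟨b, -, -, h⟩
    · rw [h, List.mem_singleton] at hS
      subst hS
      simp
    · rw [h] at hS; cases hS
    · rw [h, List.mem_filter] at hS
      exact (mem_smallSets hS.1).2.2
  have hne : separators n d cs ≠ [] := by
    intro h
    obtain ⟨h1, h2⟩ := separatorsBelow_eq_nil h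
    obtain ⟨b, hb, S, hS, hS'⟩ := hB h1
    rw [h2 b (by omega) S hS] at hS'
    cases hS'
  rw [solve, List.any_eq_true]
  constructor
  · rintro ⟨S, hS, h⟩
    exact (solveWith_iff hcs (hlt S hS)).1 h
  · intro h
    obtain ⟨S, hS⟩ := List.exists_mem_of_ne_nil _ hne
    exact ⟨S, hS, (solveWith_iff hcs (hlt S hS)).2 h⟩

/-! ### Separators of graphs of bounded treewidth -/

/-- A tree with a root has a parent function. -/
theorem exists_parent {N : Type} {T : SimpleGraph N} (hT : T.IsTree) (r : N) :
    ∃ par : N → N, (∀ s, par s = s ∨ T.dist r (par s) < T.dist r s) ∧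
      ∀ s u, T.Adj s u → u = par s ∨ s = par u := by
  classical
  -- Two neighbours of `s` closer to the root would start two different shortest paths from `s` to
  -- the root.
  have huniq : ∀ s u u', T.Adj s u → T.Adj s u' → T.dist r s = T.dist r u + 1 →
      T.dist r s = T.dist r u' + 1 → u = u' := by
    intro s u u' hu hu' hd hd'
    obtain ⟨q, hq⟩ := (hT.connected u r).exists_walk_length_eq_dist
    obtain ⟨q', hq'⟩ := (hT.connected u' r).exists_walk_length_eq_dist
    rw [T.dist_comm] at hq hq'
    have h1 : (SimpleGraph.Walk.cons hu q).IsPath :=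
      SimpleGraph.Walk.isPath_of_length_eq_dist _ (by
        rw [SimpleGraph.Walk.length_cons, hq, T.dist_comm (u := s), hd])
    have h2 : (SimpleGraph.Walk.cons hu' q').IsPath :=
      SimpleGraph.Walk.isPath_of_length_eq_dist _ (by
        rw [SimpleGraph.Walk.length_cons, hq', T.dist_comm (u := s), hd'])
    have := congrArg Subtype.val ((hT.isAcyclic.subsingleton_path s r).elim ⟨_, h1⟩ ⟨_, h2⟩)
    simpa using congrArg SimpleGraph.Walk.snd this
  let par : N → N := fun s =>
    if h : ∃ u, T.Adj s u ∧ T.dist r s = T.dist r u + 1 then h.choose else s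
  have hpar : ∀ s u, T.Adj s u → T.dist r s = T.dist r u + 1 → u = par s := by
    intro s u h1 h2
    have h : ∃ u, T.Adj s u ∧ T.dist r s = T.dist r u + 1 := ⟨u, h1, h2⟩
    simp only [par, dif_pos h]
    exact huniq s _ _ h1 h.choose_spec.1 h2 h.choose_spec.2
  refine ⟨par, fun s => ?_, fun s u h => ?_⟩
  · by_cases h : ∃ u, T.Adj s u ∧ T.dist r s = T.dist r u + 1
    · right
      simp only [par, dif_pos h]
      have := h.choose_spec.2
      omega
    · left
      simp only [par, dif_neg h]
  · rcases hT.dist_eq_dist_add_one_of_adj r h with h' | h'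
    · exact .inl (hpar s u h h')
    · exact .inr (hpar u s h.symm h')

/-- `t` is an ancestor of `s`, or `s` itself, for the parent function `par`. -/
def Below {N : Type} (par : N → N) (s t : N) : Prop := ∃ j, par^[j] s = t

namespace Below

variable {N : Type} {par : N → N} {s t u : N}

theorem refl (s : N) : Below par s s := ⟨0, rfl⟩

theorem trans (h : Below par s t) (h' : Below par t u) : Below par s u := by
  obtain ⟨i, rfl⟩ := h
  obtain ⟨j, rfl⟩ := h'
  exact ⟨j + i, Function.iterate_add_apply _ _ _ _⟩

theorem iterate_le {i j : ℕ} (h : i ≤ j) : Below par (par^[i] s) (par^[j] s) :=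
  ⟨j - i, by rw [← Function.iterate_add_apply, Nat.sub_add_cancel h]⟩

theorem total (h : Below par s t) (h' : Below par s u) : Below par t u ∨ Below par u t := by
  obtain ⟨i, rfl⟩ := h
  obtain ⟨j, rfl⟩ := h'
  exact (le_total i j).imp iterate_le iterate_le

theorem depth {depth : N → ℕ} (hd : ∀ s, par s = s ∨ depth (par s) < depth s)
    (h : Below par s t) : s = t ∨ depth t < depth s := by
  obtain ⟨j, rfl⟩ := h
  induction j with
  | zero => exact .inl rfl
  | succ j ih =>
    rw [Function.iterate_succ_apply']
    rcases hd (par^[j] s) with h | h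
    · rwa [h]
    · rcases ih with ih | ih
      · rw [← ih] at h ⊢; exact .inr h
      · exact .inr (h.trans ih)

/-- On the way up from `s`, this is the last node before `t`; the inequality `t' ≠ t` excludes the
root, which is its own parent. -/
theorem exists_child (h : Below par s t) (hne : s ≠ t) :
    ∃ t', par t' = t ∧ t' ≠ t ∧ Below par s t' := by
  obtain ⟨j, rfl⟩ := h
  induction j with
  | zero => exact absurd rfl hne
  | succ j ih =>
    rw [Function.iterate_succ_apply'] at hne ⊢
    by_cases h : par^[j] s = par (par^[j] s)
    · rw [← h] at hne ⊢; exact ih hne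
    · exact ⟨_, rfl, h, j, rfl⟩

end Below

/-- In a connected set of nodes, all ancestors up to the highest node belong to the set. -/
theorem exists_iterate_parent {N : Type} {T : SimpleGraph N} {par : N → N} {depth : N → ℕ}
    (hd : ∀ s, par s = s ∨ depth (par s) < depth s)
    (hadj : ∀ s u, T.Adj s u → u = par s ∨ s = par u) {X : Set N} {t s : N}
    (hmin : ∀ s ∈ X, depth t ≤ depth s) (ht : t ∈ X)
    (hs : Relation.ReflTransGen (fun a b => T.Adj a b ∧ b ∈ X) t s) :
    ∃ j, par^[j] s = t ∧ ∀ i ≤ j, par^[i] s ∈ X := by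
  induction hs with
  | refl => exact ⟨0, rfl, fun i hi => by rw [Nat.le_zero.1 hi]; exact ht⟩
  | @tail s u _ h ih =>
    obtain ⟨j, hj, hX⟩ := ih
    rcases hadj s u h.1 with rfl | rfl
    · cases j with
      | zero =>
        obtain rfl : s = t := hj
        rcases hd s with h' | h'
        · exact absurd h'.symm h.1.ne
        · exact absurd (hmin _ h.2) (by omega)
      | succ j =>
        rw [Function.iterate_succ_apply] at hj
        exact ⟨j, hj, fun i hi => by
          rw [← Function.iterate_succ_apply]; exact hX (i + 1) (by omega)⟩
    · refine ⟨j + 1, hj, fun i hi => ?_⟩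
      cases i with
      | zero => exact h.2
      | succ i => exact hX i (by omega)

/-- A tree decomposition in terms of a parent function and of the highest node `top v` whose bag
contains `v`. -/
theorem IsTreeDecomposition.exists_top {V : Type} {G : SimpleGraph V} {m : ℕ}
    {T : SimpleGraph (Fin m)} {bag : Fin m → Finset V} (h : IsTreeDecomposition G T bag) :
    ∃ (par : Fin m → Fin m) (depth : Fin m → ℕ) (top : V → Fin m) (r : Fin m),
      (∀ s, par s = s ∨ depth (par s) < depth s) ∧ (∀ s, Below par s r) ∧
      ∀ v s, v ∈ bag s → ∃ j, par^[j] s = top v ∧ ∀ i ≤ j, v ∈ bag (par^[i] s) := by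
  classical
  obtain ⟨r⟩ := h.isTree.connected.nonempty
  obtain ⟨par, hd, hadj⟩ := exists_parent h.isTree r
  have htop : ∀ v, ∃ t, v ∈ bag t ∧ ∀ s, v ∈ bag s → T.dist r t ≤ T.dist r s := fun v => by
    obtain ⟨t, ht, hmin⟩ := (Finset.univ.filter fun s => v ∈ bag s).exists_min_image
      (fun s => T.dist r s) (by obtain ⟨i, hi⟩ := h.vertex v; exact ⟨i, by simpa using hi⟩)
    exact ⟨t, by simpa using ht, fun s hs => hmin s (by simpa using hs)⟩
  choose top htop hmin using htop
  refine ⟨par, T.dist r, top, r, hd, fun s => ?_, fun v s hs => ?_⟩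
  · obtain ⟨j, hj, -⟩ := exists_iterate_parent (X := Set.univ) (t := r) hd hadj
      (fun s _ => by simp) trivial
      (((T.reachable_iff_reflTransGen _ _).1 (h.isTree.connected r s)).lift id
        fun a b h => ⟨h, trivial⟩)
    exact ⟨j, hj⟩
  · refine exists_iterate_parent (X := {i | v ∈ bag i}) hd hadj (hmin v) (htop v) ?_
    have hr := h.connected v ⟨top v, htop v⟩ ⟨s, hs⟩
    rw [SimpleGraph.reachable_iff_reflTransGen] at hr
    exact hr.lift Subtype.val fun a b hab => ⟨hab, b.2⟩

/-- Greedy cutting from below: as long as more than `p` vertices remain, the bag of a deepest node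
with more than `p` of them in its subtree is deleted. This costs at most `w` and disposes of at
least `p + 1` vertices, whence the quotient. The sets `X` need not be connected: being closed under
adjacency outside `S`, they contain the components. -/
theorem IsTreeDecomposition.exists_separator {V : Type} [Fintype V] {G : SimpleGraph V} {m : ℕ}
    {T : SimpleGraph (Fin m)} {bag : Fin m → Finset V} (h : IsTreeDecomposition G T bag) {w : ℕ}
    (hw : ∀ i, (bag i).card ≤ w) (p : ℕ) :
    ∃ S : Finset V, S.card ≤ w * (Fintype.card V / (p + 1)) ∧ ∀ v ∉ S, ∃ X : Finset V, v ∈ X ∧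
      X.card ≤ p ∧ ∀ x ∈ X, ∀ y ∉ S, G.Adj x y → y ∈ X := by
  classical
  obtain ⟨par, depth, top, r, hd, hr, htop⟩ := h.exists_top
  have hbelow : ∀ v s, v ∈ bag s → Below par s (top v) := fun v s hs =>
    (htop v s hs).imp fun j hj => hj.1
  have hself : ∀ v, v ∈ bag (top v) := fun v => by
    obtain ⟨s, hs⟩ := h.vertex v
    obtain ⟨j, hj, hj'⟩ := htop v s hs
    exact hj ▸ hj' j le_rfl
  -- The bags containing `v` include every node between `s` and `top v`. If the number `a` of steps
  -- passes `top v`, then `t` and `top v` lie above each other, so they coincide by their depths.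
  have hconv : ∀ v s t, v ∈ bag s → Below par s t → Below par t (top v) → v ∈ bag t := by
    rintro v s t hs ⟨a, rfl⟩ ht
    obtain ⟨j, hj, hj'⟩ := htop v s hs
    rcases le_total a j with haj | haj
    · exact hj' a haj
    · have h1 : Below par (top v) (par^[a] s) := hj ▸ Below.iterate_le haj
      rcases h1.depth hd with h2 | h2
      · rw [← h2]; exact hself v
      · rcases ht.depth hd with h3 | h3
        · rw [h3]; exact hself v
        · omega
  -- Both tops are ancestors of a bag containing `x` and `y`, so they are comparable, and the bag at
  -- the lower one contains both vertices.
  have hadj : ∀ x y, G.Adj x y → (Below par (top x) (top y) ∧ y ∈ bag (top x)) ∨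
      (Below par (top y) (top x) ∧ x ∈ bag (top y)) := by
    intro x y hxy
    obtain ⟨i, hx, hy⟩ := h.edge x y hxy
    have hx' := hbelow x i hx
    have hy' := hbelow y i hy
    rcases hx'.total hy' with h' | h'
    · exact .inl ⟨h', hconv y i _ hy hx' h'⟩
    · exact .inr ⟨h', hconv x i _ hx hy' h'⟩
  -- The induction runs over the set `W` of vertices not yet cut off; the tree and its bags remain
  -- unchanged.
  suffices H : ∀ W : Finset V, ∃ S : Finset V, S.card ≤ w * (W.card / (p + 1)) ∧ ∀ v ∈ W, v ∉ S →
      ∃ X : Finset V, X ⊆ W ∧ v ∈ X ∧ X.card ≤ p ∧ ∀ x ∈ X, x ∉ S ∧ ∀ y ∈ W, y ∉ S →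
        G.Adj x y → y ∈ X by
    obtain ⟨S, hS, hX⟩ := H Finset.univ
    refine ⟨S, hS, fun v hv => ?_⟩
    obtain ⟨X, -, h1, h2, h3⟩ := hX v (Finset.mem_univ v) hv
    exact ⟨X, h1, h2, fun x hx y hy => (h3 x hx).2 y (Finset.mem_univ y) hy⟩
  intro W
  induction W using Finset.strongInduction with
  | H W ih =>
  let D : Fin m → Finset V := fun t => W.filter fun v => Below par (top v) t
  have hD : ∀ t v, v ∈ D t ↔ v ∈ W ∧ Below par (top v) t := fun t v => by simp [D]
  by_cases hWp : W.card ≤ p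
  · exact ⟨∅, by simp, fun v hv _ => ⟨W, subset_rfl, hv, hWp, fun x _ =>
      ⟨Finset.notMem_empty x, fun y hy _ _ => hy⟩⟩⟩
  obtain ⟨t, ht, hmax⟩ := (Finset.univ.filter fun t => p < (D t).card).exists_max_image depth
    ⟨r, by
      have : D r = W := Finset.filter_true_of_mem fun v _ => hr _
      simp only [Finset.mem_filter, Finset.mem_univ, true_and, this]
      omega⟩
  simp only [Finset.mem_filter, Finset.mem_univ, true_and] at ht hmax
  -- By maximality of the depth of `t`, no child of `t` has more than `p` vertices below it.
  have hchild : ∀ t', par t' = t → t' ≠ t → (D t').card ≤ p := by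
    intro t' ht' hne
    by_contra hcard
    have h1 := hmax t' (by omega)
    rcases hd t' with h2 | h2
    · exact hne (h2.symm.trans ht')
    · rw [ht'] at h2; omega
  have hDW : D t ⊆ W := Finset.filter_subset _ _
  obtain ⟨S, hS, hX⟩ := ih (W \ D t) (by
    refine Finset.ssubset_iff_subset_ne.2 ⟨Finset.sdiff_subset, fun he => ?_⟩
    have := Finset.card_sdiff_add_card_eq_card hDW
    rw [he] at this
    omega)
  -- An edge that leaves the part cut off at `t` has its outer end in the bag of `t`, which is
  -- deleted.
  have hcross : ∀ x y, ¬ Below par (top x) t → Below par (top y) t → G.Adj x y → x ∈ bag t := by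
    intro x y hx hy hxy
    rcases hadj x y hxy with ⟨h1, -⟩ | ⟨h1, h2⟩
    · exact absurd (h1.trans hy) hx
    · rcases h1.total hy with h3 | h3
      · exact absurd h3 hx
      · exact hconv x _ t h2 hy h3
  refine ⟨bag t ∪ S, ?_, fun v hv hvS => ?_⟩
  · have h1 := Finset.card_sdiff_add_card_eq_card hDW
    have h2 : (W \ D t).card / (p + 1) + 1 ≤ W.card / (p + 1) := by
      rw [Nat.le_div_iff_mul_le (by omega), add_mul, one_mul]
      have := Nat.div_mul_le_self (W \ D t).card (p + 1)
      omega
    calc (bag t ∪ S).card ≤ (bag t).card + S.card := Finset.card_union_le _ _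
      _ ≤ w + w * ((W \ D t).card / (p + 1)) := Nat.add_le_add (hw t) hS
      _ = w * ((W \ D t).card / (p + 1) + 1) := by ring
      _ ≤ _ := Nat.mul_le_mul_left _ h2
  simp only [Finset.mem_union, not_or] at hvS ⊢
  by_cases hvt : Below par (top v) t
  · obtain ⟨t', ht', hne, hvt'⟩ := hvt.exists_child fun he => hvS.1 (he ▸ hself v)
    have ht't : Below par t' t := ⟨1, ht'⟩
    refine ⟨(D t').filter fun x => x ∉ bag t ∧ x ∉ S, fun x hx => ?_, ?_, ?_, fun x hx => ?_⟩
    · simp only [Finset.mem_filter, hD] at hx; exact hx.1.1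
    · simp only [Finset.mem_filter, hD]; exact ⟨⟨hv, hvt'⟩, hvS⟩
    · exact (Finset.card_le_card (Finset.filter_subset _ _)).trans (hchild t' ht' hne)
    · simp only [Finset.mem_filter, hD] at hx ⊢
      refine ⟨hx.2, fun y hy hyS hxy => ⟨⟨hy, ?_⟩, hyS⟩⟩
      rcases hadj x y hxy with ⟨h1, h2⟩ | ⟨h1, -⟩
      · rcases h1.total hx.1.2 with h3 | h3
        · exact h3
        by_contra h4
        -- If `top y` is not below the child `t'`, it lies strictly above `t'`, hence at or above
        -- `t`; then `y` belongs to the deleted bag of `t`.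
        have h5 : Below par t (top y) := by
          obtain ⟨j, hj⟩ := h3
          cases j with
          | zero => exact absurd (hj ▸ Below.refl _) h4
          | succ j => exact ⟨j, by rw [← hj, Function.iterate_succ_apply, ht']⟩
        exact hyS.1 (hconv y _ t h2 (hx.1.2.trans ht't) h5)
      · exact h1.trans hx.1.2
  · obtain ⟨X, hXW, hvX, hcard, hclosed⟩ := hX v (by simp [hD, hv, hvt]) hvS.2
    refine ⟨X.filter fun x => x ∉ bag t, fun x hx => ?_, by simp [hvX, hvS.1],
      (Finset.card_le_card (Finset.filter_subset _ _)).trans hcard, fun x hx => ?_⟩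
    · exact (Finset.mem_sdiff.1 (hXW (Finset.mem_filter.1 hx).1)).1
    · obtain ⟨hxX, hxt⟩ := Finset.mem_filter.1 hx
      refine ⟨⟨hxt, (hclosed x hxX).1⟩, fun y hy hyS hxy => Finset.mem_filter.2 ⟨?_, hyS.1⟩⟩
      have hx' := Finset.mem_sdiff.1 (hXW hxX)
      have hxb : ¬ Below par (top x) t := fun hb => hx'.2 ((hD t x).2 ⟨hx'.1, hb⟩)
      refine (hclosed x hxX).2 y (Finset.mem_sdiff.2 ⟨hy, fun hyD => ?_⟩) hyS.2 hxy
      exact hxt (hcross x y hxb ((hD t y).1 hyD).2 hxy)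

/-! ### Instances as data -/

/-- The constraints as lists of numbers. -/
def Constraint.data {n d : ℕ} (K : Constraint n d) : List ℕ × List (List ℕ) :=
  (K.scope.map Fin.val, K.rel.map (List.map Fin.val))

theorem encList_map {X Y : Type} (f : Y → BinTree) (g : X → Y) (l : List X) :
    encList (fun x => f (g x)) l = encList f (l.map g) := by
  induction l with
  | nil => rfl
  | cons a l ih => rw [encList, ih]; rfl

theorem Constraint.encode_eq {n d : ℕ} (K : Constraint n d) : K.encode = enc K.data := by
  rw [Constraint.encode, Constraint.data, enc_pair]
  congr 1
  · exact encList_map encNat Fin.val K.scope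
  · rw [← funext fun l : List (Fin d) => (encList_map encNat Fin.val l).symm]
    exact encList_map (encList encNat) (List.map Fin.val) K.rel

namespace Instance

def data (I : Instance) : ℕ × ℕ × List (List ℕ × List (List ℕ)) :=
  (I.vars, I.dom, I.cons.map Constraint.data)

theorem encode_eq (I : Instance) : I.encode = enc I.data := by
  rw [encode, data, enc_pair, enc_pair]
  congr 2
  rw [funext (Constraint.encode_eq (n := I.vars) (d := I.dom))]
  exact encList_map enc Constraint.data I.cons

theorem esize_data (I : Instance) : esize I.data = I.inputSize := by
  rw [inputSize, encode_eq, esize]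

theorem five_le_inputSize (I : Instance) : 5 ≤ I.inputSize := by
  rw [← esize_data, data, esize_pair, esize_pair]
  have := esize_pos I.vars
  have := esize_pos I.dom
  have := esize_pos (I.cons.map Constraint.data)
  dsimp only
  omega

theorem data_scope (I : Instance) : ∀ K ∈ I.cons.map Constraint.data,
    K.1 ≠ [] ∧ ∀ x ∈ K.1, x < I.vars := by
  intro K hK
  obtain ⟨K, -, rfl⟩ := List.mem_map.1 hK
  refine ⟨by simpa [Constraint.data] using K.scope_ne_nil, fun x hx => ?_⟩
  simp only [Constraint.data, List.mem_map] at hx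
  obtain ⟨x, -, rfl⟩ := hx
  exact x.2

theorem consistent_iff (I : Instance) : I.Consistent ↔ ∃ τ : ℕ → ℕ, (∀ x < I.vars, τ x < I.dom) ∧
    ∀ K ∈ I.cons.map Constraint.data, K.1.map τ ∈ K.2 := by
  have key : ∀ (τ : ℕ → ℕ) (τ' : Fin I.vars → Fin I.dom), (∀ x : Fin I.vars, τ x = τ' x) →
      ∀ K : Constraint I.vars I.dom, K.data.1.map τ ∈ K.data.2 ↔ K.scope.map τ' ∈ K.rel := by
    intro τ τ' h K
    have : K.data.1.map τ = (K.scope.map τ').map Fin.val := by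
      simp [Constraint.data, h]
    rw [this]
    exact List.mem_map_of_injective (List.map_injective_iff.2 Fin.val_injective)
  constructor
  · rintro ⟨τ, hτ⟩
    refine ⟨fun x => if h : x < I.vars then τ ⟨x, h⟩ else 0, fun x hx => by simp [hx], ?_⟩
    intro K hK
    obtain ⟨K, hK', rfl⟩ := List.mem_map.1 hK
    exact (key _ τ (fun x => by simp) K).2 (hτ K hK')
  · rintro ⟨τ, hτ, h⟩
    exact ⟨fun x => ⟨τ x, hτ x x.2⟩, fun K hK =>
      (key τ _ (fun x => rfl) K).1 (h _ (List.mem_map_of_mem hK))⟩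

end Instance

theorem Ev.decidesWithin {ι : Type} {C : Ctx ι} {ans : ι → Bool} (h : Ev C ans) :
    ∃ (P : Prog) (c : ℕ), ∀ i, DecidesWithin P (C.x i) (ans i = true) ((C.B i + 2) ^ c) := by
  obtain ⟨-, T, ⟨c, hc⟩, hP⟩ := h
  obtain ⟨P, hP⟩ := hP 0
  refine ⟨P, c, fun i => ?_⟩
  obtain ⟨t, σ', hex, ht, h0, -⟩ := hP i (initStore (C.x i)) rfl
  refine ⟨t, σ', hex, ?_, ht.trans (hc i)⟩
  rw [h0]
  cases ans i <;> simp [enc_true, enc_false]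

/-! ### Separators in instances of bounded treewidth -/

/-- New variables are put in front, so `smallSets` lists each set in decreasing order; hence the
reversal. -/
theorem reverse_filter_mem_smallSets {n b : ℕ} {p : ℕ → Bool}
    (h : ((List.range n).filter p).length ≤ b) :
    ((List.range n).filter p).reverse ∈ smallSets n b := by
  induction n with
  | zero => simp [smallSets]
  | succ n ih =>
    rw [List.range_succ, List.filter_append, List.length_append] at h
    have ih := ih (by omega)
    rw [smallSets_succ, List.range_succ, List.filter_append, List.mem_append]
    by_cases hp : p n = true
    · right
      refine List.mem_map.2 ⟨_, List.mem_filter.2 ⟨ih, ?_⟩, ?_⟩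
      · simpa [hp] using h
      · simp [hp]
    · left
      simpa [hp] using ih

theorem component_nodup {n : ℕ} {cs : List (List ℕ × List (List ℕ))} {S : List ℕ} {v : ℕ} :
    (component n cs S v).Nodup := by
  rw [← expand_component]
  exact List.nodup_range.filter _

theorem hasTreewidthLE_treewidth {V : Type} [Fintype V] (G : SimpleGraph V) :
    HasTreewidthLE G (treewidth G) :=
  Nat.sInf_mem (s := {k | HasTreewidthLE G k}) ⟨_, hasTreewidthLE_card G⟩

theorem Instance.exists_separates (I : Instance) {p b : ℕ} (hp : p ≤ b)
    (hb : (I.tw + 1) * (I.vars / (p + 1)) ≤ b) :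
    ∃ S ∈ smallSets I.vars b, separates I.vars (I.cons.map Constraint.data) b S = true := by
  classical
  obtain ⟨m, T, bag, hT, hcard⟩ := hasTreewidthLE_treewidth I.primalGraph
  obtain ⟨S, hS, hX⟩ := hT.exists_separator hcard p
  rw [Fintype.card_fin] at hS
  let q : ℕ → Bool := fun x => decide (∃ h : x < I.vars, (⟨x, h⟩ : Fin I.vars) ∈ S)
  have hq : ∀ x : Fin I.vars, x.1 ∈ ((List.range I.vars).filter q).reverse ↔ x ∈ S := fun x => by
    simp [q]
  have hle : ∀ (l : List ℕ) (X : Finset (Fin I.vars)), l.Nodup →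
      (∀ x ∈ l, ∃ y ∈ X, y.1 = x) → l.length ≤ X.card := by
    intro l X hl hlX
    rw [← List.toFinset_card_of_nodup hl, ← Finset.card_map Fin.valEmbedding]
    refine Finset.card_le_card fun x hx => ?_
    simpa using hlX x (List.mem_toFinset.1 hx)
  refine ⟨_, reverse_filter_mem_smallSets (p := q) ?_, List.all_eq_true.2 fun v hv => ?_⟩
  · refine ((hle _ S (List.nodup_range.filter _) fun x hx => ?_).trans hS).trans hb
    obtain ⟨h, hS⟩ := of_decide_eq_true (List.mem_filter.1 hx).2
    exact ⟨_, hS, rfl⟩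
  · rw [decide_eq_true_eq]
    have hv := List.mem_range.1 hv
    -- For a deleted vertex the component is empty by convention.
    by_cases hvS : (⟨v, hv⟩ : Fin I.vars) ∈ S
    · refine (hle _ ∅ component_nodup fun x hx => ?_).trans (Nat.zero_le _)
      exact absurd (component_subset (X := ∅) (fun _ h => absurd ((hq ⟨v, hv⟩).2 hvS) h)
        (by simp) hx) (Set.notMem_empty x)
    · obtain ⟨X, hvX, hXp, hX⟩ := hX _ hvS
      refine ((hle _ X component_nodup fun x hx => ?_).trans hXp).trans hp
      refine component_subset (X := {x | ∃ y ∈ X, y.1 = x}) (fun _ _ => ⟨_, hvX, rfl⟩) ?_ hx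
      rintro _ ⟨x, hx, rfl⟩ y hy hyS K hK hxK hyK
      by_cases hxy : x.1 = y
      · exact ⟨x, hx, hxy⟩
      refine ⟨⟨y, hy⟩, hX x hx _ (fun h => hyS ((hq ⟨y, hy⟩).2 h)) ⟨fun h => hxy ?_, ?_⟩, rfl⟩
      · rw [h]
      · obtain ⟨K, hK', rfl⟩ := List.mem_map.1 hK
        simp only [Constraint.data, List.mem_map] at hxK hyK
        obtain ⟨x', hx', hxx⟩ := hxK
        obtain ⟨y', hy', rfl⟩ := hyK
        rw [Fin.ext hxx] at hx'
        exact ⟨K, hK', hx', hy'⟩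

/-! ### The number of small sets -/

theorem length_smallSets_le_two_pow (n b : ℕ) : (smallSets n b).length ≤ 2 ^ n := by
  induction n with
  | zero => simp [smallSets]
  | succ n ih =>
    rw [smallSets_succ, List.length_append, List.length_map, pow_succ]
    have := List.length_filter_le (fun S : List ℕ => decide (S.length + 1 ≤ b)) (smallSets n b)
    omega

/-- Each set `S` gets the weight u^(b - |S|) ≥ 1. Adding a new variable multiplies the total weight
by at most 1 + 1/u, as sets containing it weigh 1/u of the sets they extend. Multiplication by uⁿ
clears denominators. -/
theorem pow_mul_length_smallSets_le {u : ℕ} (hu : 1 ≤ u) (n b : ℕ) :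
    u ^ n * (smallSets n b).length ≤ (u + 1) ^ n * u ^ b := by
  let W : List (List ℕ) → ℕ := fun L => (L.map fun S => u ^ (b - S.length)).sum
  have hW : u ^ n * W (smallSets n b) ≤ (u + 1) ^ n * u ^ b := by
    induction n with
    | zero => simp [smallSets, W]
    | succ n ih =>
      have key : ∀ L : List (List ℕ), u * W ((L.filter fun S => decide (S.length + 1 ≤ b)).map
          fun S => n :: S) ≤ W L := by
        intro L
        induction L with
        | nil => simp [W]
        | cons S L ih =>
          rw [List.filter_cons]
          split_ifs with h
          · have h' : u ^ (b - S.length) = u * u ^ (b - (S.length + 1)) := by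
              rw [← pow_succ']
              congr 1
              have := of_decide_eq_true h
              omega
            simp only [W, List.map_cons, List.sum_cons, List.length_cons, mul_add] at ih ⊢
            rw [h']
            exact Nat.add_le_add_left ih _
          · simp only [W, List.map_cons, List.sum_cons] at ih ⊢
            exact le_add_of_le_right ih
      have hsplit : W (smallSets (n + 1) b) = W (smallSets n b) + W (((smallSets n b).filter fun S =>
          decide (S.length + 1 ≤ b)).map fun S => n :: S) := by
        rw [smallSets_succ]; simp [W]
      calc u ^ (n + 1) * W (smallSets (n + 1) b)
          = u ^ n * (u * W (smallSets n b) + u * W (((smallSets n b).filter fun S =>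
              decide (S.length + 1 ≤ b)).map fun S => n :: S)) := by rw [hsplit]; ring
        _ ≤ u ^ n * (u * W (smallSets n b) + W (smallSets n b)) :=
            Nat.mul_le_mul_left _ (Nat.add_le_add_left (key _) _)
        _ = (u + 1) * (u ^ n * W (smallSets n b)) := by ring
        _ ≤ (u + 1) * ((u + 1) ^ n * u ^ b) := Nat.mul_le_mul_left _ ih
        _ = _ := by ring
  refine (Nat.mul_le_mul_left _ ?_).trans hW
  generalize smallSets n b = L
  induction L with
  | nil => simp
  | cons S L ih =>
    have := Nat.one_le_pow (b - S.length) u hu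
    simp only [W, List.map_cons, List.sum_cons, List.length_cons] at ih ⊢
    omega

/-- This is (1 + 1/u)^u ≤ e ≤ 4, applied `n / u` times; the remainder of the division accounts for
one more factor of at most 4. -/
theorem succ_pow_le {u : ℕ} (hu : 1 ≤ u) (n : ℕ) : (u + 1) ^ n ≤ u ^ n * 4 ^ (n / u + 1) := by
  have hu' : (0 : ℝ) < u := by exact_mod_cast hu
  have h1 : ((u : ℝ) + 1) ^ u ≤ u ^ u * 4 := by
    have h2 : (1 + 1 / (u : ℝ)) ^ u ≤ 4 := by
      calc (1 + 1 / (u : ℝ)) ^ u ≤ Real.exp (1 / u) ^ u := by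
            gcongr
            rw [add_comm]
            exact Real.add_one_le_exp _
        _ = Real.exp 1 := by rw [← Real.exp_nat_mul]; congr 1; field_simp
        _ ≤ 4 := by linarith [Real.exp_one_lt_d9]
    calc ((u : ℝ) + 1) ^ u = u ^ u * (1 + 1 / (u : ℝ)) ^ u := by
          rw [← mul_pow]; congr 1; field_simp
      _ ≤ _ := by gcongr
  have h2 : (u + 1) ^ u ≤ u ^ u * 4 := by exact_mod_cast h1
  have h3 : (u + 1) ^ (n % u) ≤ u ^ (n % u) * 4 := by
    have hr : n % u ≤ u := (Nat.mod_lt _ hu).le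
    refine Nat.le_of_mul_le_mul_left (c := u ^ (u - n % u)) ?_ (Nat.pow_pos hu)
    calc u ^ (u - n % u) * (u + 1) ^ (n % u) ≤ (u + 1) ^ (u - n % u) * (u + 1) ^ (n % u) :=
          Nat.mul_le_mul_right _ (Nat.pow_le_pow_left (by omega) _)
      _ = (u + 1) ^ u := by rw [← pow_add, Nat.sub_add_cancel hr]
      _ ≤ u ^ u * 4 := h2
      _ = _ := by rw [← mul_assoc, ← pow_add, Nat.sub_add_cancel hr]
  calc (u + 1) ^ n = ((u + 1) ^ u) ^ (n / u) * (u + 1) ^ (n % u) := by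
        rw [← pow_mul, ← pow_add, Nat.div_add_mod]
    _ ≤ (u ^ u * 4) ^ (n / u) * (u ^ (n % u) * 4) :=
        Nat.mul_le_mul (Nat.pow_le_pow_left h2 _) h3
    _ = (u ^ (u * (n / u)) * u ^ (n % u)) * (4 ^ (n / u) * 4) := by
        rw [mul_pow, ← pow_mul]; ring
    _ = _ := by rw [← pow_add, Nat.div_add_mod, pow_succ]

/-! ### Subexponential functions -/

/-- A constant factor is absorbed by passing from `μ` to `μ / k`, which is still monotone and
unbounded; the threshold is raised until this quotient is positive. -/
theorem littleOEff_of_mul_le {f μ : ℕ → ℕ} {k n₀ : ℕ} (hf : Computable f) (hμ : Computable μ)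
    (hmono : Monotone μ) (hunb : ∀ b, ∃ n, b ≤ μ n) (hk : 0 < k)
    (h : ∀ n ≥ n₀, f n * μ n ≤ k * n) : LittleOEff f fun n => n := by
  obtain ⟨n₁, hn₁⟩ := hunb k
  refine ⟨hf, Computable.id, fun n => μ n / k,
    (Primrec.nat_div.to_comp.comp hμ (Computable.const k)), fun a b hab =>
      Nat.div_le_div_right (hmono hab), fun b => ?_, max n₀ n₁, fun n hn => ?_⟩
  · obtain ⟨n, hn⟩ := hunb (b * k)
    exact ⟨n, (Nat.le_div_iff_mul_le hk).2 hn⟩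
  · have h1 : k ≤ μ n := hn₁.trans (hmono ((le_max_right _ _).trans hn))
    have hpos : 0 < μ n / k := Nat.div_pos h1 hk
    refine ⟨hpos, ?_⟩
    rw [le_div_iff₀ (by exact_mod_cast hpos)]
    have h2 : f n * (μ n / k) ≤ n := by
      refine Nat.le_of_mul_le_mul_left (c := k) ?_ hk
      calc k * (f n * (μ n / k)) = f n * (μ n / k * k) := by ring
        _ ≤ f n * μ n := Nat.mul_le_mul_left _ (Nat.div_mul_le_self _ _)
        _ ≤ _ := h n ((le_max_left _ _).trans hn)
    exact_mod_cast h2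

theorem LittleOEff.exists_mul_le {f : ℕ → ℕ} (h : LittleOEff f fun n => n) :
    ∃ μ : ℕ → ℕ, Computable μ ∧ Monotone μ ∧ (∀ b, ∃ n, b ≤ μ n) ∧
      ∃ n₀, ∀ n ≥ n₀, f n * μ n ≤ n := by
  obtain ⟨-, -, μ, hμ, hmono, hunb, n₀, h⟩ := h
  refine ⟨μ, hμ, hmono, hunb, n₀, fun n hn => ?_⟩
  obtain ⟨hpos, h⟩ := h n hn
  rw [le_div_iff₀ (by exact_mod_cast hpos)] at h
  exact_mod_cast h

theorem LittleOEff.const_mul {f : ℕ → ℕ} (h : LittleOEff f fun n => n) (c : ℕ) :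
    LittleOEff (fun n => c * f n) fun n => n := by
  obtain ⟨μ, hμ, hmono, hunb, n₀, hle⟩ := h.exists_mul_le
  refine littleOEff_of_mul_le (k := c + 1) (n₀ := n₀)
    (Primrec.nat_mul.to_comp.comp (Computable.const c) h.1) hμ hmono hunb (by omega) fun n hn => ?_
  rw [mul_assoc]
  exact Nat.mul_le_mul (by omega) (hle n hn)

theorem LittleOEff.comp_mul {f : ℕ → ℕ} (h : LittleOEff f fun n => n) {K : ℕ} (hK : 0 < K) :
    LittleOEff (fun n => f (K * n)) fun n => n := by
  obtain ⟨μ, hμ, hmono, hunb, n₀, hle⟩ := h.exists_mul_le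
  refine littleOEff_of_mul_le (k := K) (n₀ := n₀)
    (h.1.comp (Primrec.nat_mul.to_comp.comp (Computable.const K) Computable.id))
    hμ hmono hunb hK fun n hn => ?_
  have hn' : n ≤ K * n := Nat.le_mul_of_pos_left n hK
  exact (Nat.mul_le_mul_left _ (hmono hn')).trans (hle _ (hn.trans hn'))

/-- With b = p = ⌊n/u²⌋ one has n/(p+1) ≤ u², so the separator bound requires (s+1)·u⁴ ≤ n. It
follows from s·μ ≤ n and u⁸ ≤ min(μ, n) once u ≥ 2. The number of small sets is at most (1+1/u)ⁿ ·
u^b, where both factors are 2^O(n/u). -/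
theorem LittleOEff.exists_bound {s : ℕ → ℕ} (hs : LittleOEff s fun n => n) :
    ∃ g : ℕ → ℕ, LittleOEff g (fun n => n) ∧ ∀ n, ∃ b p, b ≤ n ∧ p ≤ b ∧
      (s n + 1) * (n / (p + 1)) ≤ b ∧ b ≤ g n ∧ ∀ b' ≤ b, (smallSets n b').length ≤ 2 ^ g n := by
  obtain ⟨μ, hμ, hmono, hunb, n₀, hle⟩ := hs.exists_mul_le
  -- Three square roots give an eighth root that is evidently computable and monotone.
  let u : ℕ → ℕ := fun n => (min (μ n) n).sqrt.sqrt.sqrt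
  have hu8 : ∀ n, u n ^ 8 ≤ min (μ n) n := fun n => by
    have h1 := Nat.sqrt_le' (min (μ n) n)
    have h2 := Nat.sqrt_le' (min (μ n) n).sqrt
    have h3 := Nat.sqrt_le' (min (μ n) n).sqrt.sqrt
    calc u n ^ 8 = ((u n ^ 2) ^ 2) ^ 2 := by ring
      _ ≤ ((min (μ n) n).sqrt.sqrt ^ 2) ^ 2 :=
        Nat.pow_le_pow_left (Nat.pow_le_pow_left h3 2) 2
      _ ≤ (min (μ n) n).sqrt ^ 2 := Nat.pow_le_pow_left h2 2
      _ ≤ _ := h1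
  have humono : Monotone u := fun a b hab =>
    Nat.sqrt_le_sqrt (Nat.sqrt_le_sqrt (Nat.sqrt_le_sqrt (min_le_min (hmono hab) hab)))
  have huunb : ∀ b, ∃ n, b ≤ u n := fun b => by
    obtain ⟨n, hn⟩ := hunb (((b ^ 2) ^ 2) ^ 2)
    refine ⟨max n (((b ^ 2) ^ 2) ^ 2), ?_⟩
    simp only [u, Nat.le_sqrt']
    exact le_min (hn.trans (hmono (le_max_left _ _))) (le_max_right _ _)
  have hucomp : Computable u :=
    Primrec.nat_sqrt.to_comp.comp (Primrec.nat_sqrt.to_comp.comp (Primrec.nat_sqrt.to_comp.comp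
      (Primrec.nat_min.to_comp.comp hμ Computable.id)))
  obtain ⟨n₂, hn₂⟩ := huunb 2
  let n₁ := max n₀ n₂
  -- Below the threshold, where nothing is known about `s`, the trivial choice b = p = n works.
  -- Above it, the exponent 2(n/u + 1) + n/u is at most 5(n/u), because n/u ≥ 1.
  let g : ℕ → ℕ := fun n => bif decide (n < n₁) then n else 5 * (n / u n)
  have hgcomp : Computable g :=
    Computable.cond ((Primrec.nat_lt.comp Primrec.id (Primrec.const n₁)).decide.to_comp)
      Computable.id (Primrec.nat_mul.to_comp.comp (Computable.const 5)
        (Primrec.nat_div.to_comp.comp Computable.id hucomp))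
  refine ⟨g, littleOEff_of_mul_le (k := 5) (n₀ := n₁) hgcomp hucomp humono huunb (by omega)
    fun n hn => ?_, fun n => ?_⟩
  · simp only [g, decide_eq_false (show ¬ n < n₁ by omega), cond_false]
    rw [mul_assoc]
    exact Nat.mul_le_mul_left _ (Nat.div_mul_le_self _ _)
  by_cases hn : n < n₁
  · refine ⟨n, n, le_rfl, le_rfl, ?_, ?_, fun b' _ => ?_⟩
    · rw [Nat.div_eq_of_lt (by omega)]; simp
    · simp [g, hn]
    · simpa [g, hn] using length_smallSets_le_two_pow n b'
  have hg : g n = 5 * (n / u n) := by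
    simp only [g, decide_eq_false hn, cond_false]
  have hu2 : 2 ≤ u n := hn₂.trans (humono (by omega))
  have hs' := hle n (by omega)
  have h8 := hu8 n
  rw [hg]
  generalize u n = u at *
  have h8μ : u ^ 8 ≤ μ n := h8.trans (min_le_left _ _)
  have h8n : u ^ 8 ≤ n := h8.trans (min_le_right _ _)
  have hu0 : 0 < u := by omega
  have hun : 1 ≤ n / u := by
    rw [Nat.le_div_iff_mul_le hu0, one_mul]
    exact (Nat.le_self_pow (by norm_num) u).trans h8n
  have hb : n / u ^ 2 * u ≤ n / u := by
    rw [Nat.le_div_iff_mul_le hu0, mul_assoc, ← sq]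
    exact Nat.div_mul_le_self _ _
  have hbu : n / u ^ 2 ≤ n / u := (Nat.le_mul_of_pos_right _ hu0).trans hb
  refine ⟨n / u ^ 2, n / u ^ 2, Nat.div_le_self _ _, le_rfl, ?_, by omega, fun b' hb' => ?_⟩
  · have hq : n / (n / u ^ 2 + 1) ≤ u ^ 2 := by
      refine (Nat.div_lt_of_lt_mul ?_).le
      rw [mul_comm]
      exact Nat.lt_mul_div_succ n (by positivity)
    refine (Nat.mul_le_mul_left _ hq).trans ?_
    rw [Nat.le_div_iff_mul_le (by positivity)]
    have h4 : 2 ≤ u ^ 4 := le_trans (by norm_num) (Nat.pow_le_pow_left hu2 4)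
    have h5 : 2 * u ^ 4 ≤ u ^ 8 := by
      calc 2 * u ^ 4 ≤ u ^ 4 * u ^ 4 := Nat.mul_le_mul_right _ h4
        _ = _ := by ring
    have h6 : s n * (2 * u ^ 4) ≤ n :=
      (Nat.mul_le_mul_left _ (h5.trans h8μ)).trans hs'
    have h7 : (s n + 1) * u ^ 2 * u ^ 2 * 2 = s n * (2 * u ^ 4) + 2 * u ^ 4 := by ring
    omega
  · have h1 := pow_mul_length_smallSets_le hu0 n b'
    have h2 : u ^ b' ≤ 2 ^ (n / u) := by
      calc u ^ b' ≤ (2 ^ u) ^ b' := Nat.pow_le_pow_left Nat.lt_two_pow_self.le _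
        _ = 2 ^ (u * b') := (pow_mul _ _ _).symm
        _ ≤ 2 ^ (n / u) := Nat.pow_le_pow_right (by norm_num) (by
          rw [mul_comm]; exact (Nat.mul_le_mul_right _ hb').trans hb)
    refine Nat.le_of_mul_le_mul_left (c := u ^ n) ?_ (by positivity)
    calc u ^ n * (smallSets n b').length ≤ (u + 1) ^ n * u ^ b' := h1
      _ ≤ (u ^ n * 4 ^ (n / u + 1)) * 2 ^ (n / u) := Nat.mul_le_mul (succ_pow_le hu0 n) h2
      _ = u ^ n * 2 ^ (2 * (n / u + 1) + n / u) := by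
        rw [pow_add 2, pow_mul 2]; ring
      _ ≤ _ := Nat.mul_le_mul_left _ (Nat.pow_le_pow_right (by norm_num) (by omega))

/-! ### The upper bound -/

theorem add_two_pow_le {B : ℕ} (hB : 2 ≤ B) (c : ℕ) : (B + 2) ^ c ≤ B ^ (2 * c) := by
  rw [pow_mul]
  exact Nat.pow_le_pow_left (by nlinarith) c

/-- The budget is |I| · (max dom 1)^g(n). A polynomial in it is at most its power with exponent `2 *
c`, which becomes the factor `2 * c` in front of `g` and the exponent of |I|. For dom ≥ 2, the
number 2^g(n) of sets is at most dom^g(n). -/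
theorem solvableInSubexpTime_of_littleOEff {s : ℕ → ℕ} (hs : LittleOEff s fun n => n) :
    SolvableInSubexpTime {I | I.tw ≤ s I.vars} := by
  obtain ⟨g, hg, hbound⟩ := hs.exists_bound
  let C : Ctx {I : Instance // I.tw ≤ s I.vars} :=
    ⟨fun I => I.1.inputSize * (max I.1.dom 1) ^ g I.1.vars, fun I => I.1.encode⟩
  have hB : ∀ I : {I : Instance // I.tw ≤ s I.vars}, ∃ b ≤ I.1.vars, (∃ S ∈ smallSets I.1.vars b,
      separates I.1.vars (I.1.cons.map Constraint.data) b S = true) ∧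
      (∀ b' ≤ b, (smallSets I.1.vars b').length ≤ 2 ^ g I.1.vars) ∧ b ≤ g I.1.vars := by
    intro I
    obtain ⟨b, p, h1, h2, h3, h4, h5⟩ := hbound I.1.vars
    exact ⟨b, h1, I.1.exists_separates h2
      ((Nat.mul_le_mul_right _ (Nat.add_le_add_right I.2 1)).trans h3), h5, h4⟩
  have hdata : Ev C fun I => I.1.data := .input
    (PolyBdd.self.mono fun I => by
      rw [Instance.esize_data]
      exact Nat.le_mul_of_pos_right _ (by positivity)) fun I => I.1.encode_eq
  have hCB : ∀ I, 2 ≤ I.1.dom → I.1.dom ^ g I.1.vars ≤ (C.B I + 2) ^ 1 := by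
    intro I hI
    have : I.1.dom ^ g I.1.vars ≤ C.B I := by
      simp only [C]
      rw [max_eq_left (by omega)]
      exact Nat.le_mul_of_pos_left _ (by have := I.1.five_le_inputSize; omega)
    rw [pow_one]
    omega
  have hsolve : Ev C fun I => solve I.1.vars I.1.dom (I.1.cons.map Constraint.data) := by
    refine hdata.fst.solve hdata.snd.fst hdata.snd.snd ⟨1, fun I hI => ?_⟩
    obtain ⟨b, h1, h2, h3, h4⟩ := hB I
    exact ⟨b, h1, h2, fun b' hb' => ((h3 b' hb').trans (Nat.pow_le_pow_left hI _)).trans (hCB I hI),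
      (Nat.pow_le_pow_right (by omega) h4).trans (hCB I hI)⟩
  obtain ⟨P, c, hP⟩ := hsolve.decidesWithin
  refine ⟨P, fun n => 2 * c * g n, 1, 2 * c, hg.const_mul _, fun I hI => ?_⟩
  obtain ⟨t, σ, hex, hans, ht⟩ := hP ⟨I, hI⟩
  refine ⟨t, σ, hex, hans.trans ?_, ht.trans ?_⟩
  · rw [Instance.consistent_iff]
    exact solve_iff I.data_scope fun _ => by
      obtain ⟨b, h1, ⟨S, h2, h3⟩, -⟩ := hB ⟨I, hI⟩
      exact ⟨b, h1, S, h2, h3⟩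
  · refine (add_two_pow_le (B := C.B ⟨I, hI⟩) ?_ c).trans ?_
    · simp only [C]
      have := I.five_le_inputSize
      exact le_trans (by omega) (Nat.le_mul_of_pos_right _ (by positivity))
    · simp only [C]
      rw [mul_pow, ← pow_mul, one_mul, mul_comm, mul_comm (g I.vars)]

/-! ### Padding -/

def Constraint.castLE {n n' d : ℕ} (h : n ≤ n') (K : Constraint n d) : Constraint n' d where
  scope := K.scope.map (Fin.castLE h)
  rel := K.rel
  scope_ne_nil := by simpa using K.scope_ne_nil
  scope_nodup := K.scope_nodup.map (Fin.castLE_injective h)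
  rel_nodup := K.rel_nodup
  length_eq := by simpa using K.length_eq

/-- The unary constraint on `x` that is always satisfied. -/
def Constraint.full {n : ℕ} (x : Fin n) (d : ℕ) : Constraint n d where
  scope := [x]
  rel := (List.finRange d).map fun a => [a]
  scope_ne_nil := by simp
  scope_nodup := by simp
  rel_nodup := (List.nodup_finRange d).map fun a b h => by simpa using h
  length_eq := by simp

namespace Instance

variable {k : ℕ}

/-- The instance with `k` times as many variables, where the new ones are not constrained. -/
def pad (I : Instance) (hk : 0 < k) : Instance where
  vars := k * I.vars
  dom := I.dom
  cons := I.cons.map (Constraint.castLE (Nat.le_mul_of_pos_left _ hk)) ++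
    -- Each variable must occur in a scope, so every new one receives a unary constraint that allows
    -- all values.
    ((List.finRange (k * I.vars)).filter fun x => decide (I.vars ≤ x.1)).map fun x => .full x I.dom
  cons_distinct := by
    rw [List.pairwise_append]
    refine ⟨?_, ?_, ?_⟩
    · rw [List.pairwise_map]
      refine I.cons_distinct.imp fun {K K'} h h' => h ⟨?_, h'.2⟩
      exact List.map_injective_iff.2 (Fin.castLE_injective _) h'.1
    · rw [List.pairwise_map]
      refine ((List.nodup_finRange _).filter _).imp fun {x y} h h' => h ?_
      simpa [Constraint.full] using h'.1
    · intro K hK K' hK' h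
      obtain ⟨K, -, rfl⟩ := List.mem_map.1 hK
      obtain ⟨x, hx, rfl⟩ := List.mem_map.1 hK'
      have hx' : x ∈ K.scope.map (Fin.castLE (Nat.le_mul_of_pos_left I.vars hk)) := by
        have : K.scope.map (Fin.castLE (Nat.le_mul_of_pos_left I.vars hk)) = [x] := h.1
        simp [this]
      obtain ⟨y, -, rfl⟩ := List.mem_map.1 hx'
      have := y.2
      have : I.vars ≤ y.1 := by simpa using (List.mem_filter.1 hx).2
      omega
  var_occurs := fun x => by
    by_cases hx : x.1 < I.vars
    · obtain ⟨K, hK, hxK⟩ := I.var_occurs ⟨x, hx⟩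
      exact ⟨_, List.mem_append_left _ (List.mem_map_of_mem hK), List.mem_map_of_mem hxK⟩
    · refine ⟨.full x I.dom, List.mem_append_right _ (List.mem_map_of_mem ?_), ?_⟩
      · simpa using hx
      · simp [Constraint.full]
  dom_occurs := fun a => by
    obtain ⟨K, hK, r, hr, ha⟩ := I.dom_occurs a
    exact ⟨_, List.mem_append_left _ (List.mem_map_of_mem hK), r, hr, ha⟩

theorem data_pad (I : Instance) (hk : 0 < k) : (I.pad hk).data = (k * I.vars, I.dom,
    I.cons.map Constraint.data ++ ((List.range (k * I.vars)).filter fun x =>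
      decide (I.vars ≤ x)).map fun x => ([x], (List.range I.dom).map fun a => [a])) := by
  have h1 : ∀ d, (List.finRange d).map Fin.val = List.range d := fun d => by simp
  rw [data, pad]
  refine congrArg _ (congrArg _ ?_)
  rw [List.map_append, List.map_map, List.map_map, ← h1 (k * I.vars), List.filter_map, List.map_map]
  congr 1
  · exact List.map_congr_left fun K _ => by simp [Constraint.data, Constraint.castLE]
  · refine List.map_congr_left fun x _ => ?_
    change ([x.1], ((List.finRange I.dom).map fun a => [a]).map (List.map Fin.val)) = ([x.1], _)
    rw [← h1 I.dom, List.map_map, List.map_map]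
    rfl

theorem consistent_pad_iff (I : Instance) (hk : 0 < k) : (I.pad hk).Consistent ↔ I.Consistent := by
  have hle : I.vars ≤ k * I.vars := Nat.le_mul_of_pos_left _ hk
  have hcons : (I.pad hk).cons.map Constraint.data = I.cons.map Constraint.data ++
      ((List.range (k * I.vars)).filter fun x => decide (I.vars ≤ x)).map fun x =>
        ([x], (List.range I.dom).map fun a => [a]) :=
    congrArg (fun p => p.2.2) (I.data_pad hk)
  rw [consistent_iff, consistent_iff, hcons]
  change (∃ τ : ℕ → ℕ, (∀ x < k * I.vars, τ x < I.dom) ∧ _) ↔ _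
  constructor
  · rintro ⟨τ, h1, h2⟩
    exact ⟨τ, fun x hx => h1 x (by omega), fun K hK => h2 K (List.mem_append_left _ hK)⟩
  · rintro ⟨τ, h1, h2⟩
    have h3 : ∀ x < k * I.vars, (if x < I.vars then τ x else 0) < I.dom := by
      intro x hx
      split_ifs with h
      · exact h1 x h
      -- New variables get the value `0`, which needs a non-empty domain; an old variable exists as
      -- soon as there is a new one, and its value shows this.
      · have : 0 < I.vars := Nat.pos_of_ne_zero fun h0 => by simp [h0] at hx
        exact (Nat.zero_le _).trans_lt (h1 0 this)
    refine ⟨fun x => if x < I.vars then τ x else 0, h3, fun K hK => ?_⟩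
    rcases List.mem_append.1 hK with hK | hK
    · rw [List.map_congr_left fun x hx => if_pos ((I.data_scope K hK).2 x hx)]
      exact h2 K hK
    · obtain ⟨x, hx, rfl⟩ := List.mem_map.1 hK
      simp only [List.mem_filter, List.mem_range] at hx
      simpa using h3 x hx.1

/-- Take any tree on the set of all variables, and as bag of `i` the old variables together with
`i`. Old variables are in all bags, a new one only in its own, and new variables have no neighbours.
-/
theorem tw_pad_le (I : Instance) (hk : 0 < k) : (I.pad hk).tw ≤ I.vars := by
  classical
  refine Nat.sInf_le (?_ : HasTreewidthLE (I.pad hk).primalGraph I.vars)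
  -- Without variables there would be no node for the tree, so this case is separate.
  rcases Nat.eq_zero_or_pos I.vars with h0 | hpos
  · have := hasTreewidthLE_card (I.pad hk).primalGraph
    have h : Fintype.card (Fin (I.pad hk).vars) = I.vars := by
      rw [Fintype.card_fin]; simp [pad, h0]
    rwa [h] at this
  have hne : Nonempty (Fin (I.pad hk).vars) := ⟨⟨0, Nat.mul_pos hk hpos⟩⟩
  obtain ⟨T, -, hT⟩ := (SimpleGraph.connected_top (V := Fin (I.pad hk).vars)).exists_isTree_le
  refine ⟨_, T, fun i => Finset.univ.filter fun v => v.1 < I.vars ∨ v = i,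
    ⟨hT, fun v => ⟨v, by simp⟩, fun u v huv => ?_, fun v => ?_⟩, fun i => ?_⟩
  · obtain ⟨hne, K, hK, hu, hv⟩ := huv
    rcases List.mem_append.1 hK with hK | hK
    · obtain ⟨K, -, rfl⟩ := List.mem_map.1 hK
      obtain ⟨u', -, rfl⟩ := List.mem_map.1 hu
      obtain ⟨v', -, rfl⟩ := List.mem_map.1 hv
      exact ⟨Fin.castLE (Nat.le_mul_of_pos_left _ hk) u',
        Finset.mem_filter.2 ⟨Finset.mem_univ _, .inl u'.2⟩,
        Finset.mem_filter.2 ⟨Finset.mem_univ _, .inl v'.2⟩⟩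
    · obtain ⟨x, -, rfl⟩ := List.mem_map.1 hK
      exact absurd ((List.mem_singleton.1 hu).trans (List.mem_singleton.1 hv).symm) hne
  · by_cases hv : v.1 < I.vars
    · rw [show {i | v ∈ Finset.univ.filter fun v => v.1 < I.vars ∨ v = i} = Set.univ by
        ext; simp [hv]]
      exact (SimpleGraph.induceUnivIso T).preconnected_iff.2 hT.connected.preconnected
    · rintro ⟨a, ha⟩ ⟨b, hb⟩
      obtain rfl : v = a := (by simpa using ha : v.1 < I.vars ∨ v = a).resolve_left hv
      obtain rfl : v = b := (by simpa using hb : v.1 < I.vars ∨ v = b).resolve_left hv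
      exact SimpleGraph.Reachable.refl _
  · have h1 : (Finset.univ.filter fun v : Fin (I.pad hk).vars => v.1 < I.vars).card ≤ I.vars := by
      rw [← Finset.card_map Fin.valEmbedding]
      refine (Finset.card_le_card (t := Finset.range I.vars) fun x hx => ?_).trans
        (Finset.card_range _).le
      simp only [Finset.mem_map, Finset.mem_filter] at hx
      obtain ⟨y, hy, rfl⟩ := hx
      exact Finset.mem_range.2 hy.2
    dsimp only
    rw [Finset.filter_or]
    refine (Finset.card_union_le _ _).trans (Nat.add_le_add h1 ?_)
    refine (Finset.card_le_card (t := {i}) fun x hx => ?_).trans (Finset.card_singleton i).le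
    simpa using hx

end Instance

theorem Ev.data_pad {ι : Type} {C : Ctx ι} {I : ι → Instance} {k : ℕ} (hk : 0 < k)
    (h : Ev C fun i => (I i).data) : Ev C fun i => ((I i).pad hk).data := by
  refine (((h.fst.mul_const k).pair (h.snd.fst.pair (h.snd.snd.append
    (((h.fst.mul_const k).range.filter (p := fun i x => decide ((I i).vars ≤ x))
      fun _ _ _ _ hE hx _ => (hE.lift h.fst).le hx).map
        (f := fun i x => ([x], (List.range (I i).dom).map fun a => [a]))
          fun _ _ _ _ hE hx _ => (hx.cons (const [])).pair ((hE.lift h.snd.fst).range.map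
            (f := fun _ a => [a]) fun _ _ _ _ _ ha _ => ha.cons (const [])))))).congr
      fun i => (I i).data_pad hk)

/-! ### Sequential composition of programs -/

/-- A program writes to finitely many registers. They can therefore be reset after the padding, as
the given decision program presupposes a clean initial store. -/
theorem Prog.exists_register_bound (P : Prog) :
    ∃ M, ∀ σ t σ', Exec P σ t σ' → ∀ j > M, σ' j = σ j := by
  induction P with
  | assign x e =>
    refine ⟨x, fun σ t σ' h j hj => ?_⟩
    cases h
    exact Function.update_of_ne (by omega) _ _
  | seq P Q ihP ihQ =>
    obtain ⟨M, hM⟩ := ihP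
    obtain ⟨N, hN⟩ := ihQ
    refine ⟨max M N, fun σ t σ' h j hj => ?_⟩
    cases h with
    | seq h₁ h₂ => rw [hN _ _ _ h₂ j (by omega), hM _ _ _ h₁ j (by omega)]
  | ite e P Q ihP ihQ =>
    obtain ⟨M, hM⟩ := ihP
    obtain ⟨N, hN⟩ := ihQ
    refine ⟨max M N, fun σ t σ' h j hj => ?_⟩
    cases h with
    | ite_true _ h => exact hM _ _ _ h j (by omega)
    | ite_false _ h => exact hN _ _ _ h j (by omega)
  | loop e P ihP =>
    obtain ⟨M, hM⟩ := ihP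
    refine ⟨M, fun σ t σ' h j hj => ?_⟩
    generalize hL : Prog.loop e P = L at h
    induction h with
    | assign => cases hL
    | seq => cases hL
    | ite_true => cases hL
    | ite_false => cases hL
    | loop_done => rfl
    | loop_step _ h₁ _ _ ih =>
      cases hL
      rw [ih rfl, hM _ _ _ h₁ j hj]

/-- Reset the registers `1, …, k`. -/
def Prog.clear : ℕ → Prog
  | 0 => .assign 0 (.var 0)
  | k + 1 => .seq (clear k) (.assign (k + 1) .nil)

theorem Prog.runs_clear (k : ℕ) (σ : Store) : Runs (clear k) σ (k + 1) fun σ' =>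
    σ' 0 = σ 0 ∧ (∀ j, 1 ≤ j → j ≤ k → σ' j = .nil) ∧ ∀ j > k, σ' j = σ j := by
  induction k with
  | zero =>
    refine .assign ⟨by simp [Exp.eval], fun j _ _ => by omega, fun j hj => ?_⟩
    exact Function.update_of_ne (by omega) _ _
  | succ k ih =>
    refine Runs.seq ih fun σ' h => .assign ⟨?_, fun j h1 h2 => ?_, fun j hj => ?_⟩
    · rw [Function.update_of_ne (by omega), h.1]
    · by_cases hj : j = k + 1
      · subst hj; simp [Exp.eval]
      · rw [Function.update_of_ne hj, h.2.1 j h1 (by omega)]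
    · rw [Function.update_of_ne (by omega), h.2.2 j (by omega)]

/-- A program for a function that leaves no traces in other registers. -/
theorem Ev.exists_clean {ι Y : Type} [Enc Y] {C : Ctx ι} {y : ι → Y} (h : Ev C y) :
    ∃ (P : Prog) (c M : ℕ), ∀ i, Runs P (initStore (C.x i)) ((C.B i + 2) ^ c + M) fun σ =>
      σ = initStore (enc (y i)) := by
  obtain ⟨-, T, ⟨c, hc⟩, hP⟩ := h
  obtain ⟨P, hP⟩ := hP 0
  obtain ⟨M, hM⟩ := P.exists_register_bound
  refine ⟨.seq P (.clear M), c, M + 1, fun i => ?_⟩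
  obtain ⟨t, σ, hex, ht, h0, -⟩ := hP i (initStore (C.x i)) rfl
  refine Runs.seq (Q := fun σ' => σ' = σ) ⟨t, σ, hex, ht.trans (hc i), rfl⟩ fun σ' hσ' => ?_
  subst hσ'
  refine (Prog.runs_clear M σ').mono le_rfl fun σ'' h => funext fun j => ?_
  rcases Nat.eq_zero_or_pos j with rfl | hj
  · rw [h.1, h0]; rfl
  · have hinit : ∀ x, initStore x j = .nil := fun x => if_neg (by omega)
    rw [hinit]
    rcases Nat.lt_or_ge M j with hjM | hjM
    · rw [h.2.2 j hjM, hM _ _ _ hex j hjM, hinit]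
    · exact h.2.1 j hj hjM

/-! ### The lower bound -/

/-- The given program is run on the padded instance, which has the same domain and polynomial size;
since `k` is constant, f(k·n) is still effectively o(n). -/
theorem solvableInSubexpTime_univ {s : ℕ → ℕ} (hs : IsOmegaLinear s)
    (h : SolvableInSubexpTime {I | I.tw ≤ s I.vars}) : SolvableInSubexpTime Set.univ := by
  obtain ⟨c, hc, n₀, hs⟩ := hs
  obtain ⟨P, f, a, b, hf, hP⟩ := h
  obtain ⟨k₀, hk₀⟩ := exists_nat_ge (1 / c)
  -- This `k` satisfies c·k ≥ 1, so that s(k·n) ≥ c·k·n ≥ n; as it also exceeds `n₀`, the hypothesis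
  -- on `s` applies to k·n for every n > 0.
  have hk : 0 < k₀ + n₀ + 1 := by omega
  generalize hkdef : k₀ + n₀ + 1 = k at hk
  have htw : ∀ I : Instance, (I.pad hk).tw ≤ s (k * I.vars) := by
    intro I
    refine (I.tw_pad_le hk).trans ?_
    rcases Nat.eq_zero_or_pos I.vars with h0 | hpos
    · rw [h0]; exact Nat.zero_le _
    have h1 : n₀ ≤ k * I.vars := by
      calc n₀ ≤ k := by omega
        _ ≤ k * I.vars := Nat.le_mul_of_pos_right _ hpos
    have h2 := hs _ h1
    have h3 : 1 ≤ c * (k : ℝ) := by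
      rw [div_le_iff₀ hc] at hk₀
      have : (k₀ : ℝ) ≤ k := by exact_mod_cast (by omega : k₀ ≤ k)
      nlinarith
    have h4 : (I.vars : ℝ) ≤ s (k * I.vars) := by
      refine le_trans ?_ h2
      push_cast
      nlinarith [(Nat.cast_nonneg I.vars : (0 : ℝ) ≤ I.vars)]
    exact_mod_cast h4
  let C : Ctx Instance := ⟨Instance.inputSize, Instance.encode⟩
  have hdata : Ev C fun I => I.data :=
    .input (PolyBdd.self.mono fun I => I.esize_data.le) fun I => I.encode_eq
  have hpad := hdata.data_pad hk
  obtain ⟨e, he⟩ := hpad.size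
  obtain ⟨Q, q, M, hQ⟩ := hpad.exists_clean
  refine ⟨.seq Q P, fun n => f (k * n), 1 + M + a, 2 * q + 2 * e * b, hf.comp_mul hk, fun I _ => ?_⟩
  obtain ⟨t₁, σ₁, hex₁, ht₁, rfl⟩ := hQ I
  obtain ⟨t₂, σ₂, hex₂, hans, ht₂⟩ := hP (I.pad hk) (htw I)
  rw [Instance.encode_eq] at hex₂
  refine ⟨t₁ + t₂, σ₂, .seq hex₁ hex₂, hans.trans (I.consistent_pad_iff hk), ?_⟩
  have hI : 2 ≤ I.inputSize := le_trans (by norm_num) I.five_le_inputSize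
  have hI1 : 1 ≤ I.inputSize := by omega
  have h1 : t₁ ≤ I.inputSize ^ (2 * q) + M :=
    ht₁.trans (Nat.add_le_add_right (add_two_pow_le hI q) M)
  have h2 : (I.pad hk).inputSize ^ b ≤ I.inputSize ^ (2 * e * b) := by
    rw [pow_mul]
    refine Nat.pow_le_pow_left ?_ b
    rw [← Instance.esize_data]
    exact (he I).trans (add_two_pow_le hI e)
  have h3 : t₂ ≤ a * (max I.dom 1) ^ f (k * I.vars) * I.inputSize ^ (2 * e * b) :=
    ht₂.trans (Nat.mul_le_mul_left _ h2)
  have hD : 1 ≤ (max I.dom 1) ^ f (k * I.vars) := Nat.one_le_pow _ _ (by omega)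
  dsimp only
  generalize (max I.dom 1) ^ f (k * I.vars) = D at *
  have hx : 1 ≤ I.inputSize ^ (2 * q) := Nat.one_le_pow _ _ hI1
  have hy : 1 ≤ I.inputSize ^ (2 * e * b) := Nat.one_le_pow _ _ hI1
  rw [pow_add]
  generalize I.inputSize ^ (2 * q) = x at *
  generalize I.inputSize ^ (2 * e * b) = y at *
  -- Each of the three summands (padding, clean-up, decision) is bounded by a constant times the
  -- same product `D * (x * y)`, all of whose factors are at least 1.
  have h4 : x ≤ D * (x * y) := by
    calc x = 1 * (x * 1) := by ring
      _ ≤ _ := Nat.mul_le_mul hD (Nat.mul_le_mul_left _ hy)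
  have h5 : M ≤ M * (D * (x * y)) :=
    Nat.le_mul_of_pos_right _ (Nat.mul_pos hD (Nat.mul_pos hx hy))
  have h6 : a * D * y ≤ a * (D * (x * y)) := by
    rw [mul_assoc]
    exact Nat.mul_le_mul_left _ (Nat.mul_le_mul_left _ (Nat.le_mul_of_pos_left _ hx))
  calc t₁ + t₂ ≤ x + M + a * D * y := Nat.add_le_add h1 h3
    _ ≤ D * (x * y) + M * (D * (x * y)) + a * (D * (x * y)) :=
      Nat.add_le_add (Nat.add_le_add h4 h5) h6
    _ = _ := by ring

end CSPTime

theorem mainTheorem3 :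
    (∀ s : ℕ → ℕ, CSPTime.LittleOEff s (fun n => n) →
      CSPTime.SolvableInSubexpTime {I | I.tw ≤ s I.vars}) ∧
    (∀ s : ℕ → ℕ, CSPTime.IsOmegaLinear s →
      CSPTime.SolvableInSubexpTime {I | I.tw ≤ s I.vars} →
      CSPTime.SolvableInSubexpTime Set.univ) :=
  ⟨fun _ hs => CSPTime.solvableInSubexpTime_of_littleOEff hs,
    fun _ hs h => CSPTime.solvableInSubexpTime_univ hs h⟩
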